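/- Let $n\ge 0$, let $\mathbb{F}=\mathbb{Q}(q,t)$ and $\mathbb{K}=\mathbb{Q}(q,t,a)$ be fields of rational functions, and let $\mathcal{C}_n=(\mathbb{Z}_{\ge 0})^n$, with $|\alpha|=\alpha_1+\cdots+\alpha_n$ for $\alpha\in\mathcal{C}_n$. For $v\in\mathbb{Z}^n$ define $\overline{v},\widetilde{v}\in\mathbb{F}^n$ by $$\overline{v}_i=q^{v_i}t^{-k_i(v)},\qquad k_i(v)=\#\{k<i\mid v_k\ge v_i\}+\#\{k>i\mid v_k>v_i\},\qquad \widetilde{v}=\overline{(-v_n,\ldots,-v_1)},$$ and put $\tau=(1,t^{-1},\ldots,t^{1-n})$. For every $\alpha\in\mathcal{C}_n$ there is a unique polynomial $G_\alpha\in\mathbb{F}[x_1,\ldots,x_n]$ of degree at most $|\alpha|$ such that the coefficient of $x^\alpha=x_1^{\alpha_1}\cdots x_n^{\alpha_n}$ in $G_\alpha$ is $1$ and $G_\alpha(\overline{\beta})=0$ for all $\beta\in\mathcal{C}_n$ with $|\beta|\le|\alpha|$ and $\beta\ne\alpha$ (the non-symmetric interpolation Macdonald polynomial). There is also a unique polynomial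 $G'_\alpha\in\mathbb{F}[x_1,\ldots,x_n]$ of degree at most $|\alpha|$ with the same homogeneous component of degree $|\alpha|$ as $G_\alpha$ and such that $G'_\alpha(\widetilde{\beta})=0$ for all $\beta\in\mathcal{C}_n$ with $|\beta|<|\alpha|$ (the primed interpolation polynomial). For $\alpha\in\mathcal{C}_n$ and a box $s=(i,j)$ of $\alpha$ (that is, $1\le i\le n$ and $1\le j\le\alpha_i$) let $a(s)=\alpha_i-j$ and $$l(s)=\#\{k>i\mid j\le\alpha_k\le\alpha_i\}+\#\{k<i\mid j\le\alpha_k+1\le\alpha_i\},$$ and set $n(\alpha)=\sum_{s\in\alpha}l(s)$, $n'(\alpha)=\sum_{s\in\alpha}a(s)$. Let $\alpha^+$ be the non-increasing rearrangement of $\alpha$, and let $$\tau_\alpha=(-1)^{|\alpha|}q^{n'(\alpha)}t^{-n(\alpha^+)}.$$ Then for all $\alpha\in\mathcal{C}_n$ the following identity holds in $\mathbb{K}$: $$G'_\alpha(a^{-1}\tau)=\tau_\alpha^{-1}\,a^{-|\alpha|}\,G_\alpha(a\tau).$$ -/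

import Mathlib

noncomputable section

namespace InterpolationMacdonald

open MvPolynomial

/-- The field `𝔽 = ℚ(q,t)` of rational functions in two variables over `ℚ`. -/
abbrev BaseField : Type := FractionRing (MvPolynomial (Fin 2) ℚ)

/-- The field `𝕂 = ℚ(q,t,a) = 𝔽(a)`. -/
abbrev ParamField : Type := RatFunc BaseField

/-- The variable `q` of `𝔽 = ℚ(q,t)`. -/
def q : BaseField := algebraMap (MvPolynomial (Fin 2) ℚ) BaseField (X 0)

/-- The variable `t` of `𝔽 = ℚ(q,t)`. -/
def t : BaseField := algebraMap (MvPolynomial (Fin 2) ℚ) BaseField (X 1)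

/-- The variable `a` of `𝕂 = 𝔽(a)`. -/
def a : ParamField := RatFunc.X

/-- `|α| = α₁ + ⋯ + αₙ`. -/
def size {n : ℕ} (α : Fin n → ℕ) : ℕ := ∑ i, α i

/-- `k_i(v) = #{k < i | v_k ≥ v_i} + #{k > i | v_k > v_i}`. -/
def kIndex {n : ℕ} (v : Fin n → ℤ) (i : Fin n) : ℕ :=
  (Finset.univ.filter fun k : Fin n => k < i ∧ v i ≤ v k).card +
    (Finset.univ.filter fun k : Fin n => i < k ∧ v i < v k).card

/-- The spectral vector `v̄` with entries `v̄_i = q^{v_i} t^{-k_i(v)}`. -/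
def bar {n : ℕ} (v : Fin n → ℤ) : Fin n → BaseField :=
  fun i => q ^ v i * t ^ (-(kIndex v i : ℤ))

/-- `ṽ`, the spectral vector of `-w₀v`, where `w₀` reverses the entries. -/
def tilde {n : ℕ} (v : Fin n → ℤ) : Fin n → BaseField :=
  bar fun i => -v i.rev

/-- `τ = (1, t⁻¹, …, t^{1-n})`; the entries are indexed from `0`. -/
def tau (n : ℕ) : Fin n → BaseField :=
  fun i => t ^ (-(i : ℤ))

/-- A composition, viewed as an integral vector. -/
def toInt {n : ℕ} (β : Fin n → ℕ) : Fin n → ℤ := fun i => (β i : ℤ)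

/-- The characterizing properties of the interpolation polynomial `G_α`: degree at most `|α|`,
vanishing at `β̄` for all compositions `β ≠ α` with `|β| ≤ |α|`, and coefficient `1` at `x^α`. -/
structure IsInterpolation {n : ℕ} (α : Fin n → ℕ) (P : MvPolynomial (Fin n) BaseField) :
    Prop where
  degree_le : P.totalDegree ≤ size α
  vanishing : ∀ β : Fin n → ℕ, size β ≤ size α → β ≠ α → eval (bar (toInt β)) P = 0
  normalized : P.coeff (Finsupp.equivFunOnFinite.symm α) = 1

/-- The non-symmetric interpolation Macdonald polynomial `G_α(x) = G_α(x;q,t)`. -/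
def G {n : ℕ} (α : Fin n → ℕ) : MvPolynomial (Fin n) BaseField :=
  Classical.epsilon (IsInterpolation α)

/-- The characterizing properties of the primed interpolation polynomial `G'_α`: degree at most
`|α|`, the same homogeneous component of degree `|α|` as `G_α`, and vanishing at `β̃` for all
compositions `β` with `|β| < |α|`. -/
structure IsPrimedInterpolation {n : ℕ} (α : Fin n → ℕ)
    (P : MvPolynomial (Fin n) BaseField) : Prop where
  degree_le : P.totalDegree ≤ size α
  top_eq : homogeneousComponent (size α) P = homogeneousComponent (size α) (G α)
  vanishing : ∀ β : Fin n → ℕ, size β < size α → eval (tilde (toInt β)) P = 0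

/-- The primed interpolation polynomial `G'_α(x) = G'_α(x;q,t)`. -/
def GPrime {n : ℕ} (α : Fin n → ℕ) : MvPolynomial (Fin n) BaseField :=
  Classical.epsilon (IsPrimedInterpolation α)

/-- The leg `l(s)` of the box `s = (i,j)` of `α`, with columns `j` counted from `1`. -/
def leg {n : ℕ} (α : Fin n → ℕ) (i : Fin n) (j : ℕ) : ℕ :=
  (Finset.univ.filter fun k : Fin n => i < k ∧ j ≤ α k ∧ α k ≤ α i).card +
    (Finset.univ.filter fun k : Fin n => k < i ∧ j ≤ α k + 1 ∧ α k + 1 ≤ α i).card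

/-- `n(α) = ∑_{s ∈ α} l(s)`. -/
def legSum {n : ℕ} (α : Fin n → ℕ) : ℕ :=
  ∑ i, ∑ j ∈ Finset.Icc 1 (α i), leg α i j

/-- `n'(α) = ∑_{s ∈ α} a(s)`, with arm `a(s) = α_i - j` for `s = (i,j)`, `1 ≤ j ≤ α_i`. -/
def armSum {n : ℕ} (α : Fin n → ℕ) : ℕ :=
  ∑ i, ∑ j ∈ Finset.Icc 1 (α i), (α i - j)

/-- The non-increasing rearrangement `α⁺` of `α`. -/
def plus {n : ℕ} (α : Fin n → ℕ) : Fin n → ℕ :=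
  fun i => α (Tuple.sort (fun k => OrderDual.toDual (α k)) i)

/-- `τ_α = (-1)^{|α|} q^{n'(α)} t^{-n(α⁺)}`. -/
def tauComp {n : ℕ} (α : Fin n → ℕ) : BaseField :=
  (-1) ^ size α * q ^ armSum α * t ^ (-(legSum (plus α) : ℤ))

/-- The value `P(c τ) ∈ 𝕂` of a polynomial `P` over `𝔽` at `c τ`, where `c ∈ 𝕂`. -/
def evalTau {n : ℕ} (P : MvPolynomial (Fin n) BaseField) (c : ParamField) : ParamField :=
  aeval (fun i => c * algebraMap BaseField ParamField (tau n i)) P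

end InterpolationMacdonald

end

/-!
Restrict both polynomials to the line through the origin and `τ`. There `G_α(cτ)` and `G'_α(cτ)` are
polynomials in `c` of degree at most `|α|`, and their coefficients of `c ^ |α|` agree because they
only depend on the common top component. So it suffices to find `|α|` roots of each.

The polynomial `G_α` is a joint eigenvector of the inhomogeneous Cherednik operators of Knop and
Sahi. This forces it to vanish at `β̄` for all `β`, of any size, that have a column shorter than the
corresponding column of `α`. Adding zero entries to `α` and letting new large entries of `β` vary
turns this into `G_α(cτ) = 0` for `c = q ^ j * t ^ (-i)` whenever more than `i` entries of `α`
exceed `j`. These are `|α|` distinct roots.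

The map `x ↦ t ^ (1 - n) * (xₙ, …, x₁)` sends the spectral vectors for the parameters `(q⁻¹, t⁻¹)`
to the points `β̃`, so `G'_α` composed with it is determined by the reversed top component `E_α` of
`G_α`. Let `S` be the span of the top components of the `G_β(x; q⁻¹, t⁻¹)`, where `β` runs over the
rearrangements of `α`. The sum of the `E_β` is symmetric and an eigenvector of the sum of the
Cherednik operators for `(q⁻¹, t⁻¹)`; the eigenvalue determines the multiset of the entries of `α`,
so the sum lies in `S`. As `S` is stable under the Hecke operators and the cyclic shift, each `E_β`
lies in `S`. Hence `G'_α` composed with the map is a combination of polynomials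
`G_β(x; q⁻¹, t⁻¹)` where `β` has the same column lengths as `α`, and `G'_α(cτ) = 0` for the inverses
`c` of the roots above. The two products over the boxes of `α` are then compared factor by factor.
-/

noncomputable section

namespace NonsymmetricInterpolation

open MvPolynomial
open InterpolationMacdonald (size)

section Polynomials

section CommRing
variable {σ ρ R : Type*} [CommRing R]

theorem dvd_sub_algHom_apply {φ : MvPolynomial σ R →ₐ[R] MvPolynomial σ R} {p : MvPolynomial σ R}
    (h : ∀ k, p ∣ X k - φ (X k)) (f : MvPolynomial σ R) : p ∣ f - φ f := by
  have hφ : (Ideal.Quotient.mkₐ R (Ideal.span {p})).comp φ =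
      Ideal.Quotient.mkₐ R (Ideal.span {p}) := by
    refine algHom_ext fun k => (Ideal.Quotient.eq.mpr ?_).symm
    exact Ideal.mem_span_singleton.mpr (h k)
  rw [← Ideal.mem_span_singleton]
  exact Ideal.Quotient.eq.mp (DFunLike.congr_fun hφ f).symm

theorem eval_aeval_apply (x : ρ → R) (g : σ → MvPolynomial ρ R) (f : MvPolynomial σ R) :
    eval x (aeval g f) = eval (fun k => eval x (g k)) f := by
  simp only [← coe_aeval_eq_eval, RingHom.coe_coe, ← comp_aeval_apply]

theorem sum_le_totalDegree [Fintype σ] {f : MvPolynomial σ R} {u : σ →₀ ℕ} (hu : u ∈ f.support) :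
    ∑ i, u i ≤ f.totalDegree := by
  exact (Finsupp.sum_fintype u (fun _ e => e) fun _ => rfl).symm.trans_le (le_totalDegree hu)

/-- The linear map `L` raises the degree of homogeneous polynomials by exactly `s`. -/
def IsHomogeneousMap (s : ℕ) (L : MvPolynomial σ R →ₗ[R] MvPolynomial ρ R) : Prop :=
  ∀ ⦃k f⦄, IsHomogeneous f k → IsHomogeneous (L f) (k + s)

namespace IsHomogeneousMap
variable {s : ℕ} {L : MvPolynomial σ R →ₗ[R] MvPolynomial ρ R}

theorem homogeneousComponent_apply (hL : IsHomogeneousMap s L) (f : MvPolynomial σ R) (k : ℕ) :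
    homogeneousComponent (k + s) (L f) = L (homogeneousComponent k f) := by
  have hcomp (j : ℕ) : homogeneousComponent (k + s) (L (homogeneousComponent j f)) =
      if j = k then L (homogeneousComponent j f) else 0 := by
    rw [homogeneousComponent_of_mem (hL (homogeneousComponent_isHomogeneous j f))]
    simp only [add_left_inj, eq_comm]
  conv_lhs => rw [← sum_homogeneousComponent f]
  simp only [map_sum, hcomp, Finset.sum_ite_eq', Finset.mem_range]
  split_ifs with hk
  · rfl
  · rw [homogeneousComponent_eq_zero _ _ (by omega), map_zero]

theorem totalDegree_le (hL : IsHomogeneousMap s L) {f : MvPolynomial σ R} {d : ℕ}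
    (hf : f.totalDegree ≤ d) : (L f).totalDegree ≤ d + s := by
  rw [← sum_homogeneousComponent f, map_sum]
  refine totalDegree_finsetSum_le fun i hi => ?_
  have hi' := Finset.mem_range.mp hi
  exact (hL (homogeneousComponent_isHomogeneous i f)).totalDegree_le.trans (by omega)

end IsHomogeneousMap

theorem isHomogeneousMap_aeval {g : σ → MvPolynomial ρ R} (hg : ∀ k, IsHomogeneous (g k) 1) :
    IsHomogeneousMap 0 (aeval g : MvPolynomial σ R →ₐ[R] MvPolynomial ρ R).toLinearMap :=
  fun _ _ hf => by simpa using hf.aeval g hg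

theorem isHomogeneousMap_mulLeft {l : MvPolynomial σ R} {s : ℕ} (hl : IsHomogeneous l s) :
    IsHomogeneousMap s (LinearMap.mulLeft R l) :=
  fun k _ hf => add_comm s k ▸ hl.mul hf

theorem isHomogeneous_of_mul_left [IsDomain R] {l f : MvPolynomial σ R} {s k : ℕ}
    (hl : IsHomogeneous l s) (hl0 : l ≠ 0) (h : IsHomogeneous (l * f) (k + s)) :
    IsHomogeneous f k := by
  have hf : homogeneousComponent k f = f := mul_left_cancel₀ hl0 <| by
    simpa [homogeneousComponent_of_mem h] using
      ((isHomogeneousMap_mulLeft hl).homogeneousComponent_apply f k).symm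
  exact hf ▸ homogeneousComponent_isHomogeneous k f

theorem totalDegree_le_of_mul_left [IsDomain R] {l f : MvPolynomial σ R} {d : ℕ} (hl0 : l ≠ 0)
    (h : (l * f).totalDegree ≤ l.totalDegree + d) : f.totalDegree ≤ d := by
  obtain rfl | hf := eq_or_ne f 0
  · simp
  · rw [totalDegree_mul_of_isDomain hl0 hf] at h
    omega

theorem totalDegree_le_of_homogeneousComponent_succ_eq_zero {f : MvPolynomial σ R} {d : ℕ}
    (hd : f.totalDegree ≤ d + 1) (h : homogeneousComponent (d + 1) f = 0) :
    f.totalDegree ≤ d := by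
  rw [← sum_homogeneousComponent f]
  refine totalDegree_finsetSum_le fun i hi => ?_
  obtain hid | rfl : i ≤ d ∨ i = d + 1 := by
    have := Finset.mem_range.mp hi
    omega
  · exact (homogeneousComponent_isHomogeneous i f).totalDegree_le.trans hid
  · simp [h]

theorem totalDegree_X_sub_C [Nontrivial R] (i : σ) (c : R) :
    (X i - C c : MvPolynomial σ R).totalDegree = 1 := by
  rw [sub_eq_add_neg, ← C_neg, totalDegree_add_eq_left_of_totalDegree_lt, totalDegree_X]
  simp

theorem X_sub_C_ne_zero [Nontrivial R] (i : σ) (c : R) : (X i - C c : MvPolynomial σ R) ≠ 0 := by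
  intro h
  simpa [h] using totalDegree_X_sub_C i c

end CommRing

section Field
variable {F : Type*} [Field F] {n : ℕ}

theorem degree_equivFunOnFinite_symm (γ : Fin n → ℕ) :
    (Finsupp.equivFunOnFinite.symm γ).degree = size γ := by
  simp [Finsupp.degree_eq_sum, size]

/-- Uniqueness implies existence because there are as many compositions of size at most `d` as
monomials of degree at most `d`. -/
theorem exists_interpolant_of_forall_eq_zero {d : ℕ}
    {Λ : (Fin n → ℕ) → MvPolynomial (Fin n) F →ₗ[F] F}
    (h : ∀ f, f.totalDegree ≤ d → (∀ β, size β ≤ d → Λ β f = 0) → f = 0) (c : (Fin n → ℕ) → F) :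
    ∃ f, f.totalDegree ≤ d ∧ ∀ β, size β ≤ d → Λ β f = c β := by
  let ι := {u : Fin n →₀ ℕ // (u.sum fun _ e => e) ≤ d}
  let V := restrictTotalDegree (Fin n) F d
  let basis : Module.Basis ι F V := basisRestrictSupport F _
  have hsize (u : Fin n →₀ ℕ) : (u.sum fun _ e => e) = size u :=
    Finsupp.sum_fintype _ _ fun _ => rfl
  have : Finite ι := Module.Finite.finite_basis basis
  have : Fintype ι := Fintype.ofFinite ι
  let values : V →ₗ[F] ι → F := LinearMap.pi fun u => Λ u.1 ∘ₗ V.subtype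
  have values_injective : Function.Injective values := by
    refine (injective_iff_map_eq_zero values).mpr fun f hf => Subtype.ext ?_
    refine h f ((mem_restrictTotalDegree _ _ _).mp f.2) fun β hβ => ?_
    exact congrFun hf ⟨Finsupp.equivFunOnFinite.symm β, by rwa [hsize]⟩
  have values_surjective := (LinearMap.injective_iff_surjective_of_finrank_eq_finrank
    (by rw [Module.finrank_eq_card_basis basis, Module.finrank_fintype_fun_eq_card])).mp
    values_injective
  obtain ⟨f, hf⟩ := values_surjective fun u => c u.1
  refine ⟨f, (mem_restrictTotalDegree _ _ _).mp f.2, fun β hβ => ?_⟩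
  exact congrFun hf ⟨Finsupp.equivFunOnFinite.symm β, by rwa [hsize]⟩

end Field

end Polynomials

section SpectralVectors
variable {n : ℕ}

/-- The number of entries of `v` that precede `v i` when the entries are listed in decreasing order,
equal entries from left to right. -/
def descRank {A : Type*} [LinearOrder A] (v : Fin n → A) (i : Fin n) : ℕ :=
  (Finset.univ.filter fun k => v i < v k ∨ (v i = v k ∧ k < i)).card

theorem descRank_eq_sum {A : Type*} [LinearOrder A] (v : Fin n → A) (i : Fin n) :
    descRank v i = ∑ k, if v i < v k ∨ (v i = v k ∧ k < i) then 1 else 0 :=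
  Finset.card_filter _ _

/-- The composition `(β₂, …, βₙ, β₁ + 1)`. -/
def raise (β : Fin (n + 1) → ℕ) : Fin (n + 1) → ℕ := Fin.snoc (fun k => β k.succ) (β 0 + 1)

@[simp]
theorem raise_last (β : Fin (n + 1) → ℕ) : raise β (Fin.last n) = β 0 + 1 := by
  simp [raise]

@[simp]
theorem raise_castSucc (β : Fin (n + 1) → ℕ) (i : Fin n) : raise β i.castSucc = β i.succ := by
  simp [raise]

theorem size_raise (β : Fin (n + 1) → ℕ) : size (raise β) = size β + 1 := by
  simp only [size, Fin.sum_univ_castSucc, Fin.sum_univ_succ β, raise_castSucc, raise_last]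
  ring

theorem exists_raise_eq {β : Fin (n + 1) → ℕ} (h : β (Fin.last n) ≠ 0) : ∃ γ, raise γ = β := by
  refine ⟨Fin.cons (β (Fin.last n) - 1) fun k => β k.castSucc, funext fun i => ?_⟩
  induction i using Fin.lastCases with
  | last => simpa using Nat.sub_one_add_one h
  | cast i => simp

theorem descRank_raise_last (β : Fin (n + 1) → ℕ) :
    descRank (raise β) (Fin.last n) = descRank β 0 := by
  rw [descRank_eq_sum, descRank_eq_sum, Fin.sum_univ_castSucc, Fin.sum_univ_succ]
  simp only [raise_last, raise_castSucc, Fin.castSucc_lt_last, Fin.not_lt_zero, lt_irrefl, and_true,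
    and_false, or_false, if_false, add_zero, zero_add, ← le_iff_lt_or_eq, Nat.succ_le_iff]

theorem descRank_raise_castSucc (β : Fin (n + 1) → ℕ) (i : Fin n) :
    descRank (raise β) i.castSucc = descRank β i.succ := by
  have hlast : ¬Fin.last n < i.castSucc := (Fin.le_last _).not_gt
  rw [descRank_eq_sum, descRank_eq_sum, Fin.sum_univ_castSucc, Fin.sum_univ_succ, add_comm]
  simp only [raise_last, raise_castSucc, Fin.castSucc_lt_castSucc_iff, Fin.succ_lt_succ_iff, hlast,
    Fin.succ_pos, and_true, and_false, or_false, ← le_iff_lt_or_eq, Nat.lt_succ_iff]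

theorem size_snoc_zero (β : Fin n → ℕ) : size (Fin.snoc β 0 : Fin (n + 1) → ℕ) = size β := by
  simp [size, Fin.sum_univ_castSucc]

theorem descRank_snoc_zero_castSucc (β : Fin n → ℕ) (i : Fin n) :
    descRank (Fin.snoc β 0 : Fin (n + 1) → ℕ) i.castSucc = descRank β i := by
  rw [descRank_eq_sum, descRank_eq_sum, Fin.sum_univ_castSucc]
  simp [(Fin.le_last _).not_gt]

theorem descRank_snoc_zero_last (β : Fin n → ℕ) :
    descRank (Fin.snoc β 0 : Fin (n + 1) → ℕ) (Fin.last n) = n := by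
  rw [descRank_eq_sum, Fin.sum_univ_castSucc]
  simp [Fin.castSucc_lt_last, ← le_iff_lt_or_eq]

variable {F : Type*} [Field F]

/-- The spectral vector of a composition, with entries `q ^ βᵢ * t ^ (-kᵢ(β))`. -/
def spectralVector (q t : F) (β : Fin n → ℕ) : Fin n → F := fun i => q ^ β i * t⁻¹ ^ descRank β i

theorem spectralVector_raise (q t : F) (β : Fin (n + 1) → ℕ) :
    spectralVector q t (raise β) =
      Fin.snoc (fun k => spectralVector q t β k.succ) (q * spectralVector q t β 0) := by
  funext i
  induction i using Fin.lastCases with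
  | last => simp [spectralVector, descRank_raise_last, pow_succ', mul_assoc]
  | cast i => simp [spectralVector, descRank_raise_castSucc]

theorem spectralVector_snoc_zero (q t : F) (β : Fin n → ℕ) :
    spectralVector q t (Fin.snoc β 0 : Fin (n + 1) → ℕ) =
      Fin.snoc (spectralVector q t β) (t⁻¹ ^ n) := by
  funext i
  induction i using Fin.lastCases with
  | last => simp [spectralVector, descRank_snoc_zero_last]
  | cast i => simp [spectralVector, descRank_snoc_zero_castSucc]

/-- The parameters `q` and `t` are multiplicatively independent: no nontrivial monomial in them
equals one. -/
structure IsGeneric (q t : F) : Prop where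
  q_ne_zero : q ≠ 0
  t_ne_zero : t ≠ 0
  eq_zero_of_zpow_mul_zpow_eq_one : ∀ a b : ℤ, q ^ a * t ^ b = 1 → a = 0 ∧ b = 0

namespace IsGeneric
variable {q t : F}

theorem inv (h : IsGeneric q t) : IsGeneric q⁻¹ t⁻¹ := by
  refine ⟨inv_ne_zero h.q_ne_zero, inv_ne_zero h.t_ne_zero, fun a b hab => ?_⟩
  have := h.eq_zero_of_zpow_mul_zpow_eq_one (-a) (-b) (by simpa using hab)
  omega

theorem zpow_mul_zpow_inj (h : IsGeneric q t) {a b a' b' : ℤ}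
    (he : q ^ a * t ^ b = q ^ a' * t ^ b') : a = a' ∧ b = b' := by
  have hne : q ^ a' * t ^ b' ≠ 0 :=
    mul_ne_zero (zpow_ne_zero _ h.q_ne_zero) (zpow_ne_zero _ h.t_ne_zero)
  have := h.eq_zero_of_zpow_mul_zpow_eq_one (a - a') (b - b') (by
    rw [zpow_sub₀ h.q_ne_zero, zpow_sub₀ h.t_ne_zero, div_mul_div_comm, he, div_self hne])
  omega

theorem pow_mul_inv_pow_inj (h : IsGeneric q t) {a b a' b' : ℕ}
    (he : q ^ a * t⁻¹ ^ b = q ^ a' * t⁻¹ ^ b') : a = a' ∧ b = b' := by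
  have := h.zpow_mul_zpow_inj (a := a) (b := -b) (a' := a') (b' := -b') (by simpa using he)
  omega

theorem spectralVector_ne_zero (h : IsGeneric q t) (β : Fin n → ℕ) (i : Fin n) :
    spectralVector q t β i ≠ 0 :=
  mul_ne_zero (pow_ne_zero _ h.q_ne_zero) (pow_ne_zero _ (inv_ne_zero h.t_ne_zero))

theorem spectralVector_apply_inj (h : IsGeneric q t) {β γ : Fin n → ℕ} {i j : Fin n}
    (he : spectralVector q t β i = spectralVector q t γ j) :
    β i = γ j ∧ descRank β i = descRank γ j :=
  h.pow_mul_inv_pow_inj he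

theorem spectralVector_raise_last_ne (h : IsGeneric q t) (β : Fin (n + 1) → ℕ) :
    spectralVector q t (raise β) (Fin.last n) ≠ t⁻¹ ^ n := by
  intro he
  have := h.pow_mul_inv_pow_inj (a' := 0) (b' := n) (by simpa [spectralVector] using he)
  simp at this

end IsGeneric

end SpectralVectors

section CyclicShift
variable {F : Type*} [Field F] {n : ℕ}

/-- The algebra endomorphism `f(x₁, …, xₙ) ↦ f(xₙ / q, x₁, …, xₙ₋₁)`. -/
def cyclicShift (q : F) : MvPolynomial (Fin (n + 1)) F →ₐ[F] MvPolynomial (Fin (n + 1)) F :=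
  aeval (Fin.cons (C q⁻¹ * X (Fin.last n)) fun k => X k.castSucc)

/-- The algebra endomorphism `f(x₁, …, xₙ) ↦ f(x₂, …, xₙ, q x₁)`. -/
def cyclicShiftInv (q : F) : MvPolynomial (Fin (n + 1)) F →ₐ[F] MvPolynomial (Fin (n + 1)) F :=
  aeval (Fin.snoc (fun k => X k.succ) (C q * X 0))

@[simp]
theorem cyclicShift_X_zero (q : F) :
    cyclicShift q (X (0 : Fin (n + 1))) = C q⁻¹ * X (Fin.last n) := by
  simp [cyclicShift]

@[simp]
theorem cyclicShift_X_succ (q : F) (k : Fin n) : cyclicShift q (X k.succ) = X k.castSucc := by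
  simp [cyclicShift]

@[simp]
theorem cyclicShiftInv_X_last (q : F) :
    cyclicShiftInv q (X (Fin.last n)) = C q * X (0 : Fin (n + 1)) := by
  simp [cyclicShiftInv]

@[simp]
theorem cyclicShiftInv_X_castSucc (q : F) (k : Fin n) :
    cyclicShiftInv q (X k.castSucc) = X k.succ := by
  simp [cyclicShiftInv]

theorem cyclicShiftInv_cyclicShift {q : F} (hq : q ≠ 0) (f : MvPolynomial (Fin (n + 1)) F) :
    cyclicShiftInv q (cyclicShift q f) = f := by
  have h : (cyclicShiftInv q).comp (cyclicShift q) =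
      AlgHom.id F (MvPolynomial (Fin (n + 1)) F) := by
    refine algHom_ext fun k => ?_
    induction k using Fin.cases with
    | zero => simp [algHom_C, algebraMap_eq, ← mul_assoc, ← C_mul, inv_mul_cancel₀ hq]
    | succ k => simp
  exact DFunLike.congr_fun h f

theorem cyclicShift_cyclicShiftInv {q : F} (hq : q ≠ 0) (f : MvPolynomial (Fin (n + 1)) F) :
    cyclicShift q (cyclicShiftInv q f) = f := by
  have h : (cyclicShift q).comp (cyclicShiftInv q) =
      AlgHom.id F (MvPolynomial (Fin (n + 1)) F) := by
    refine algHom_ext fun k => ?_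
    induction k using Fin.lastCases with
    | last => simp [algHom_C, algebraMap_eq, ← mul_assoc, ← C_mul, mul_inv_cancel₀ hq]
    | cast k => simp
  exact DFunLike.congr_fun h f

theorem eval_cyclicShift (q : F) (x : Fin (n + 1) → F) (f : MvPolynomial (Fin (n + 1)) F) :
    eval x (cyclicShift q f) =
      eval (Fin.cons (q⁻¹ * x (Fin.last n)) fun k => x k.castSucc) f := by
  rw [cyclicShift, eval_aeval_apply]
  congr 2
  funext k
  induction k using Fin.cases <;> simp

theorem eval_cyclicShiftInv (q : F) (x : Fin (n + 1) → F) (f : MvPolynomial (Fin (n + 1)) F) :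
    eval x (cyclicShiftInv q f) = eval (Fin.snoc (fun k => x k.succ) (q * x 0)) f := by
  rw [cyclicShiftInv, eval_aeval_apply]
  congr 2
  funext k
  induction k using Fin.lastCases <;> simp

theorem isHomogeneousMap_cyclicShift (q : F) :
    IsHomogeneousMap 0 (cyclicShift (n := n) q).toLinearMap :=
  isHomogeneousMap_aeval fun k => by
    induction k using Fin.cases with
    | zero => exact isHomogeneous_C_mul_X _ _
    | succ k => exact isHomogeneous_X _ _

theorem isHomogeneousMap_cyclicShiftInv (q : F) :
    IsHomogeneousMap 0 (cyclicShiftInv (n := n) q).toLinearMap :=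
  isHomogeneousMap_aeval fun k => by
    induction k using Fin.lastCases with
    | last => simpa using isHomogeneous_C_mul_X _ _
    | cast k => simpa using isHomogeneous_X _ _

theorem cyclicShiftInv_monomial (q : F) (u : Fin (n + 1) →₀ ℕ) (c : F) :
    cyclicShiftInv q (monomial u c) = monomial (Finsupp.equivFunOnFinite.symm
      (Fin.cons (u (Fin.last n)) fun k => u k.castSucc)) (c * q ^ u (Fin.last n)) := by
  rw [cyclicShiftInv, aeval_monomial, monomial_eq, Finsupp.prod_fintype _ _ (by simp),
    Finsupp.prod_fintype _ _ (by simp), Fin.prod_univ_castSucc, Fin.prod_univ_succ]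
  simp only [algebraMap_eq, Fin.snoc_castSucc, Fin.snoc_last, mul_pow, map_mul, map_pow,
    Finsupp.equivFunOnFinite_symm_apply_apply, Fin.cons_zero, Fin.cons_succ]
  ring

theorem coeff_cyclicShiftInv (q : F) (f : MvPolynomial (Fin (n + 1)) F) (γ : Fin (n + 1) → ℕ) :
    coeff (Finsupp.equivFunOnFinite.symm γ) (cyclicShiftInv q f) =
      q ^ γ 0 * coeff (Finsupp.equivFunOnFinite.symm
        (Fin.snoc (fun k => γ k.succ) (γ 0) : Fin (n + 1) → ℕ)) f := by
  induction f using MvPolynomial.induction_on' with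
  | monomial u c =>
    have hu : Finsupp.equivFunOnFinite.symm (Fin.cons (u (Fin.last n)) fun k => u k.castSucc) =
          Finsupp.equivFunOnFinite.symm γ ↔
        u = Finsupp.equivFunOnFinite.symm (Fin.snoc (fun k => γ k.succ) (γ 0)) := by
      rw [DFunLike.ext_iff, DFunLike.ext_iff, Fin.forall_fin_succ, Fin.forall_fin_succ']
      simp only [Finsupp.equivFunOnFinite_symm_apply_apply, Fin.cons_zero, Fin.cons_succ,
        Fin.snoc_castSucc, Fin.snoc_last]
      exact and_comm
    simp only [cyclicShiftInv_monomial, coeff_monomial, hu]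
    split_ifs with h
    · simp [h, mul_comm]
    · rw [mul_zero]
  | add p r hp hr => rw [map_add, coeff_add, coeff_add, hp, hr, mul_add]

end CyclicShift

section SubstLast
variable {R : Type*} [CommRing R] {n : ℕ}

/-- The algebra homomorphism substituting the constant `c` for the last variable. -/
def substLast (c : R) : MvPolynomial (Fin (n + 1)) R →ₐ[R] MvPolynomial (Fin n) R :=
  aeval (Fin.snoc X (C c))

theorem eval_substLast (c : R) (x : Fin n → R) (f : MvPolynomial (Fin (n + 1)) R) :
    eval x (substLast c f) = eval (Fin.snoc x c) f := by
  rw [substLast, eval_aeval_apply]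
  congr 2
  funext k
  induction k using Fin.lastCases <;> simp

theorem substLast_monomial (c : R) (u : Fin (n + 1) →₀ ℕ) (a : R) :
    substLast c (monomial u a) = monomial (Finsupp.equivFunOnFinite.symm
      fun k => u k.castSucc) (a * c ^ u (Fin.last n)) := by
  rw [substLast, aeval_monomial, monomial_eq, Finsupp.prod_fintype _ _ (by simp),
    Finsupp.prod_fintype _ _ (by simp), Fin.prod_univ_castSucc]
  simp only [algebraMap_eq, Fin.snoc_castSucc, Fin.snoc_last, map_mul, map_pow,
    Finsupp.equivFunOnFinite_symm_apply_apply]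
  ring

theorem substLast_eq_sum (c : R) (f : MvPolynomial (Fin (n + 1)) R) :
    substLast c f = ∑ u ∈ f.support, monomial (Finsupp.equivFunOnFinite.symm
      fun k => u k.castSucc) (coeff u f * c ^ u (Fin.last n)) := by
  conv_lhs => rw [f.as_sum, map_sum]
  simp only [substLast_monomial]

theorem totalDegree_substLast_le (c : R) (f : MvPolynomial (Fin (n + 1)) R) :
    (substLast c f).totalDegree ≤ f.totalDegree := by
  rw [substLast_eq_sum]
  refine totalDegree_finsetSum_le fun u hu => (totalDegree_monomial_le _ _).trans ?_
  refine le_trans ?_ (sum_le_totalDegree hu)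
  rw [Fin.sum_univ_castSucc]
  simp [Finsupp.sum_fintype]

/-- Any other monomial specialising to `x ^ α` would have a larger degree. -/
theorem coeff_substLast_of_totalDegree_le (c : R) {f : MvPolynomial (Fin (n + 1)) R}
    {α : Fin n → ℕ} (hf : f.totalDegree ≤ size α) :
    coeff (Finsupp.equivFunOnFinite.symm α) (substLast c f) =
      coeff (Finsupp.equivFunOnFinite.symm (Fin.snoc α 0 : Fin (n + 1) → ℕ)) f := by
  have eq_of_mem_support {u} (hu : u ∈ f.support) (h : (fun k : Fin n => u k.castSucc) = α) :
      u = Finsupp.equivFunOnFinite.symm (Fin.snoc α 0 : Fin (n + 1) → ℕ) := by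
    subst h
    have hlast := (sum_le_totalDegree hu).trans hf
    rw [Fin.sum_univ_castSucc, size] at hlast
    ext i
    induction i using Fin.lastCases with
    | last => simpa using hlast
    | cast i => simp
  rw [substLast_eq_sum, coeff_sum]
  simp only [coeff_monomial, EmbeddingLike.apply_eq_iff_eq]
  rw [Finset.sum_eq_single (Finsupp.equivFunOnFinite.symm (Fin.snoc α 0 : Fin (n + 1) → ℕ))]
  · simp
  · exact fun u hu hne => if_neg fun h => hne (eq_of_mem_support hu h)
  · intro h
    simp [notMem_support_iff.mp h]

theorem X_last_sub_C_dvd {c : R} {f : MvPolynomial (Fin (n + 1)) R} (h : substLast c f = 0) :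
    X (Fin.last n) - C c ∣ f := by
  have hdvd : X (Fin.last n) - C c ∣ f - (rename Fin.castSucc).comp (substLast c) f := by
    refine dvd_sub_algHom_apply (fun k => ?_) f
    induction k using Fin.lastCases with
    | last => simp [substLast, algebraMap_eq]
    | cast k => simp [substLast]
  simpa [h] using hdvd

end SubstLast

section Unisolvence
variable {F : Type*} [Field F] {n : ℕ} {q t : F}

/-- A polynomial of degree at most `d` for which every composition `β` of size at most `d` imposes
one of two linear conditions: vanishing at the spectral vector of `β` or, if `β` has size exactly
`d`, vanishing of the coefficient of `x ^ β`. Only `0` satisfies them all. -/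
structure SatisfiesMixedConditions (q t : F) (d : ℕ) (f : MvPolynomial (Fin n) F) : Prop where
  totalDegree_le : f.totalDegree ≤ d
  eval_or_coeff : ∀ β, size β ≤ d → eval (spectralVector q t β) f = 0 ∨
    (size β = d ∧ coeff (Finsupp.equivFunOnFinite.symm β) f = 0)

namespace SatisfiesMixedConditions

theorem substLast {d : ℕ} {f : MvPolynomial (Fin (n + 1)) F}
    (hf : SatisfiesMixedConditions q t d f) :
    SatisfiesMixedConditions q t d (substLast (t⁻¹ ^ n) f) := by
  refine ⟨(totalDegree_substLast_le _ f).trans hf.totalDegree_le, fun β hβ => ?_⟩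
  refine (hf.eval_or_coeff (Fin.snoc β 0) (by rwa [size_snoc_zero])).imp ?_ ?_
  · rw [eval_substLast, ← spectralVector_snoc_zero]
    exact id
  · rw [size_snoc_zero]
    rintro ⟨rfl, h⟩
    exact ⟨rfl, by rwa [coeff_substLast_of_totalDegree_le _ hf.totalDegree_le]⟩

theorem cyclicShiftInv_of_mul (hg : IsGeneric q t) {d : ℕ} {f : MvPolynomial (Fin (n + 1)) F}
    (hf : SatisfiesMixedConditions q t (d + 1) ((X (Fin.last n) - C (t⁻¹ ^ n)) * f)) :
    SatisfiesMixedConditions q t d (cyclicShiftInv q f) := by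
  have hd : f.totalDegree ≤ d := totalDegree_le_of_mul_left (X_sub_C_ne_zero _ _)
    (hf.totalDegree_le.trans (by rw [totalDegree_X_sub_C, add_comm]))
  refine ⟨(isHomogeneousMap_cyclicShiftInv q).totalDegree_le hd, fun β hβ => ?_⟩
  refine (hf.eval_or_coeff (raise β) (by rw [size_raise]; omega)).imp (fun h => ?_) fun h => ?_
  · rw [map_mul] at h
    rw [eval_cyclicShiftInv, ← spectralVector_raise]
    refine (mul_eq_zero.mp h).resolve_left ?_
    simpa [sub_eq_zero] using hg.spectralVector_raise_last_ne β
  · obtain ⟨hsize, hcoeff⟩ := h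
    rw [size_raise] at hsize
    have hraise : Finsupp.equivFunOnFinite.symm (raise β) = Finsupp.equivFunOnFinite.symm
        (Fin.snoc (fun k => β k.succ) (β 0) : Fin (n + 1) → ℕ) + Finsupp.single (Fin.last n) 1 := by
      ext i
      induction i using Fin.lastCases <;> simp
    have hlow : coeff (Finsupp.equivFunOnFinite.symm (raise β)) (C (t⁻¹ ^ n) * f) = 0 := by
      rw [coeff_C_mul, coeff_eq_zero_of_totalDegree_lt, mul_zero]
      refine hd.trans_lt (lt_of_lt_of_eq ?_ (degree_equivFunOnFinite_symm (raise β)).symm)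
      rw [size_raise]
      omega
    rw [sub_mul, coeff_sub, hlow, sub_zero, mul_comm (X _), hraise, coeff_mul_X] at hcoeff
    exact ⟨by omega, by rw [coeff_cyclicShiftInv, hcoeff, mul_zero]⟩

theorem eq_zero_of_zero_variables {d : ℕ} {f : MvPolynomial (Fin 0) F}
    (hf : SatisfiesMixedConditions q t d f) : f = 0 := by
  have hzero : (Finsupp.equivFunOnFinite.symm fun _ : Fin 0 => 0) = 0 := by
    ext i
    exact i.elim0
  obtain h | ⟨-, h⟩ := hf.eval_or_coeff (fun _ => 0) (by simp [size])
  · rw [eq_C_of_isEmpty f] at h ⊢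
    simpa using h
  · rw [eq_C_of_isEmpty f, ← hzero, h, C_0]

theorem eq_zero (hg : IsGeneric q t) {d : ℕ} {f : MvPolynomial (Fin n) F}
    (hf : SatisfiesMixedConditions q t d f) : f = 0 := by
  induction n generalizing d with
  | zero => exact hf.eq_zero_of_zero_variables
  | succ n ihn =>
    induction d generalizing f with
    | zero =>
      obtain ⟨g, rfl⟩ := X_last_sub_C_dvd (ihn hf.substLast)
      by_contra hne
      have hd := hf.totalDegree_le
      rw [totalDegree_mul_of_isDomain (X_sub_C_ne_zero _ _) (right_ne_zero_of_mul hne),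
        totalDegree_X_sub_C] at hd
      omega
    | succ d ihd =>
      obtain ⟨g, rfl⟩ := X_last_sub_C_dvd (ihn hf.substLast)
      have hshift := ihd (hf.cyclicShiftInv_of_mul hg)
      rw [← cyclicShift_cyclicShiftInv hg.q_ne_zero g, hshift, map_zero, mul_zero]

end SatisfiesMixedConditions

namespace IsGeneric

theorem eq_zero_of_eval_spectralVector_eq_zero (hg : IsGeneric q t) {d : ℕ}
    {f : MvPolynomial (Fin n) F} (hd : f.totalDegree ≤ d)
    (hf : ∀ β, size β ≤ d → eval (spectralVector q t β) f = 0) : f = 0 :=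
  SatisfiesMixedConditions.eq_zero hg ⟨hd, fun β hβ => Or.inl (hf β hβ)⟩

theorem exists_eval_spectralVector_eq (hg : IsGeneric q t) (d : ℕ) (c : (Fin n → ℕ) → F) :
    ∃ f : MvPolynomial (Fin n) F, f.totalDegree ≤ d ∧
      ∀ β, size β ≤ d → eval (spectralVector q t β) f = c β :=
  exists_interpolant_of_forall_eq_zero (Λ := fun β => (aeval (spectralVector q t β)).toLinearMap)
    (fun _ hd hf => hg.eq_zero_of_eval_spectralVector_eq_zero hd hf) c

theorem exists_vanishing_of_coeff_eq_one (hg : IsGeneric q t) (α : Fin n → ℕ) :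
    ∃ f : MvPolynomial (Fin n) F, f.totalDegree ≤ size α ∧
      (∀ β, size β ≤ size α → β ≠ α → eval (spectralVector q t β) f = 0) ∧
      coeff (Finsupp.equivFunOnFinite.symm α) f = 1 := by
  classical
  let Λ (β : Fin n → ℕ) : MvPolynomial (Fin n) F →ₗ[F] F :=
    if β = α then lcoeff F (Finsupp.equivFunOnFinite.symm α)
    else (aeval (spectralVector q t β)).toLinearMap
  have hΛ (f : MvPolynomial (Fin n) F) (hd : f.totalDegree ≤ size α)
      (hf : ∀ β, size β ≤ size α → Λ β f = 0) : f = 0 := by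
    refine SatisfiesMixedConditions.eq_zero hg ⟨hd, fun β hβ => ?_⟩
    have hval := hf β hβ
    by_cases h : β = α
    · subst h
      exact Or.inr ⟨rfl, by simpa [Λ] using hval⟩
    · exact Or.inl (by simpa [Λ, h] using hval)
  obtain ⟨f, hd, hf⟩ := exists_interpolant_of_forall_eq_zero hΛ fun β => if β = α then 1 else 0
  exact ⟨f, hd, fun β hβ hne => by simpa [Λ, hne] using hf β hβ, by simpa [Λ] using hf α le_rfl⟩

theorem eq_of_eval_of_coeff_eq (hg : IsGeneric q t) {α : Fin n → ℕ} {f g : MvPolynomial (Fin n) F}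
    (hf : f.totalDegree ≤ size α) (hg' : g.totalDegree ≤ size α)
    (heval : ∀ β, size β ≤ size α → β ≠ α →
      eval (spectralVector q t β) f = eval (spectralVector q t β) g)
    (hcoeff : coeff (Finsupp.equivFunOnFinite.symm α) f =
      coeff (Finsupp.equivFunOnFinite.symm α) g) : f = g := by
  refine sub_eq_zero.mp (SatisfiesMixedConditions.eq_zero hg
    ⟨(totalDegree_sub f g).trans (max_le hf hg'), fun β hβ => ?_⟩)
  by_cases h : β = α
  · subst h
    exact Or.inr ⟨rfl, by rw [coeff_sub, hcoeff, sub_self]⟩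
  · exact Or.inl (by rw [map_sub, heval β hβ h, sub_self])

end IsGeneric

end Unisolvence

section OrderedProducts
variable {m : ℕ}

section Monoid
variable {M : Type*} [Monoid M]

/-- The product `L i * L (i + 1) * ⋯ * L (m - 1)`. -/
def tailProd (L : Fin m → M) (i : Fin (m + 1)) : M :=
  Fin.reverseInduction (motive := fun _ => M) 1 (fun i p => L i * p) i

/-- The product `L (i - 1) * ⋯ * L 1 * L 0`. -/
def descProd (L : Fin m → M) (i : Fin (m + 1)) : M :=
  Fin.induction (motive := fun _ => M) 1 (fun i p => L i * p) i

/-- The product `L (m - 1) * ⋯ * L (i + 1) * L i`. -/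
def descTailProd (L : Fin m → M) (i : Fin (m + 1)) : M :=
  Fin.reverseInduction (motive := fun _ => M) 1 (fun i p => p * L i) i

@[simp]
theorem tailProd_last (L : Fin m → M) : tailProd L (Fin.last m) = 1 := by simp [tailProd]

@[simp]
theorem tailProd_castSucc (L : Fin m → M) (i : Fin m) :
    tailProd L i.castSucc = L i * tailProd L i.succ := by
  simp [tailProd]

@[simp]
theorem descProd_zero (L : Fin m → M) : descProd L 0 = 1 := rfl

@[simp]
theorem descProd_succ (L : Fin m → M) (i : Fin m) :
    descProd L i.succ = L i * descProd L i.castSucc := by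
  simp [descProd]

@[simp]
theorem descTailProd_last (L : Fin m → M) : descTailProd L (Fin.last m) = 1 := by
  simp [descTailProd]

@[simp]
theorem descTailProd_castSucc (L : Fin m → M) (i : Fin m) :
    descTailProd L i.castSucc = descTailProd L i.succ * L i := by
  simp [descTailProd]

variable {L : Fin m → M} {S : Submonoid M}

theorem partialProd_mem (h : ∀ i, L i ∈ S) (i : Fin (m + 1)) : Fin.partialProd L i ∈ S := by
  induction i using Fin.induction with
  | zero => simp
  | succ i ih => simpa [Fin.partialProd_succ] using S.mul_mem ih (h i)

theorem tailProd_mem (h : ∀ i, L i ∈ S) (i : Fin (m + 1)) : tailProd L i ∈ S := by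
  induction i using Fin.reverseInduction with
  | last => simp
  | cast i ih => simpa using S.mul_mem (h i) ih

theorem descProd_mem (h : ∀ i, L i ∈ S) (i : Fin (m + 1)) : descProd L i ∈ S := by
  induction i using Fin.induction with
  | zero => simp
  | succ i ih => simpa using S.mul_mem (h i) ih

theorem descTailProd_mem (h : ∀ i, L i ∈ S) (i : Fin (m + 1)) : descTailProd L i ∈ S := by
  induction i using Fin.reverseInduction with
  | last => simp
  | cast i ih => simpa using S.mul_mem ih (h i)

end Monoid

theorem val_sub_castSucc (i : Fin m) : m - (i.castSucc : ℕ) = m - (i.succ : ℕ) + 1 := by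
  simp only [Fin.val_castSucc, Fin.val_succ]
  omega

section Algebra
variable {R A : Type*} [CommSemiring R] [Semiring A] [Algebra R A] {L L' : Fin m → A} {c : R}

theorem descTailProd_mul_tailProd (h : ∀ i, L i * L' i = c • 1) (i : Fin (m + 1)) :
    descTailProd L i * tailProd L' i = c ^ (m - i : ℕ) • 1 := by
  induction i using Fin.reverseInduction with
  | last => simp
  | cast i ih =>
    rw [descTailProd_castSucc, tailProd_castSucc, mul_assoc, ← mul_assoc (L i), h, smul_one_mul,
      mul_smul_comm, ih, smul_smul, val_sub_castSucc, pow_succ']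

theorem descProd_mul_partialProd (h : ∀ i, L i * L' i = c • 1) (i : Fin (m + 1)) :
    descProd L i * Fin.partialProd L' i = c ^ (i : ℕ) • 1 := by
  induction i using Fin.induction with
  | zero => simp
  | succ i ih =>
    rw [descProd_succ, Fin.partialProd_succ, mul_assoc, ← mul_assoc (descProd L _), ih,
      smul_one_mul, mul_smul_comm, h, smul_smul, Fin.val_succ, Fin.val_castSucc, pow_succ]

end Algebra

section Module
variable {R M : Type*} [CommSemiring R] [AddCommMonoid M] [Module R M] {L : Fin m → Module.End R M}
  {c : R} {v : M}

theorem partialProd_apply_of_forall_eq_smul (h : ∀ i, L i v = c • v) (i : Fin (m + 1)) :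
    Fin.partialProd L i v = c ^ (i : ℕ) • v := by
  induction i using Fin.induction with
  | zero => simp
  | succ i ih =>
    rw [Fin.partialProd_succ, Module.End.mul_apply, h, map_smul, ih, smul_smul, Fin.val_succ,
      Fin.val_castSucc, pow_succ']

theorem descTailProd_apply_of_forall_eq_smul (h : ∀ i, L i v = c • v) (i : Fin (m + 1)) :
    descTailProd L i v = c ^ (m - i : ℕ) • v := by
  induction i using Fin.reverseInduction with
  | last => simp
  | cast i ih =>
    rw [descTailProd_castSucc, Module.End.mul_apply, h, map_smul, ih, smul_smul, val_sub_castSucc,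
      pow_succ']

end Module

section Telescoping
variable {F M : Type*} [Field F] [AddCommGroup M] [Module F M] {t : F}

theorem sum_pow_smul_eq_of_eq_add_smul_sum (ht : t ≠ 0) {u u' : Fin (m + 1) → M}
    (h : ∀ k, u' k = u k + (1 - t) • ∑ j with j < k, u j) :
    ∑ k : Fin (m + 1), t⁻¹ ^ (k : ℕ) • u' k = t⁻¹ ^ m • ∑ k, u k := by
  induction m with
  | zero => simp [h]
  | succ m ih =>
    have hlast : ∑ j with j < Fin.last (m + 1), u j = ∑ j : Fin (m + 1), u j.castSucc := by
      simp [Finset.sum_filter, Fin.sum_univ_castSucc]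
    have hcast (k : Fin (m + 1)) : u' k.castSucc =
        u k.castSucc + (1 - t) • ∑ j with j < k, u j.castSucc := by
      simp [h, Finset.sum_filter, Fin.sum_univ_castSucc, (Fin.le_last _).not_gt]
    have hpow : t⁻¹ ^ m = t⁻¹ ^ (m + 1) * t := by rw [pow_succ, inv_mul_cancel_right₀ ht]
    rw [Fin.sum_univ_castSucc, Fin.sum_univ_castSucc u, h (Fin.last _), hlast]
    simp only [Fin.val_castSucc, Fin.val_last]
    rw [ih hcast, hpow]
    module

theorem descProd_add_smul_one_apply {L : Fin m → Module.End F M} {v : M}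
    (h : ∀ (j : Fin (m + 1)) (k : Fin m), j < k.castSucc →
      L k (descProd L j v) = t • descProd L j v) (k : Fin (m + 1)) :
    descProd (fun i => L i + (1 - t) • 1) k v =
      descProd L k v + (1 - t) • ∑ j with j < k, descProd L j v := by
  induction k using Fin.induction with
  | zero => simp
  | succ k ih =>
    have hfix : (L k + (1 - t) • 1) (∑ j with j < k.castSucc, descProd L j v) =
        ∑ j with j < k.castSucc, descProd L j v := by
      rw [map_sum]
      refine Finset.sum_congr rfl fun j hj => ?_
      rw [LinearMap.add_apply, h j k (Finset.mem_filter.mp hj).2, LinearMap.smul_apply,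
        Module.End.one_apply, ← add_smul, add_sub_cancel, one_smul]
    have hinsert : Finset.univ.filter (· < k.succ) =
        insert k.castSucc (Finset.univ.filter (· < k.castSucc)) := by
      ext j
      simp [← Fin.le_castSucc_iff, le_iff_eq_or_lt]
    rw [descProd_succ, Module.End.mul_apply, ih, map_add, map_smul, hfix, hinsert,
      Finset.sum_insert (by simp), descProd_succ, LinearMap.add_apply, Module.End.mul_apply,
      LinearMap.smul_apply, Module.End.one_apply]
    module

end Telescoping

end OrderedProducts

section Stabilizer
variable {R M : Type*} [CommSemiring R] [AddCommMonoid M] [Module R M]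

/-- The algebra of endomorphisms preserving the submodule `S`. -/
def stabilizer (S : Submodule R M) : Subalgebra R (Module.End R M) where
  carrier := {L | ∀ x ∈ S, L x ∈ S}
  mul_mem' hL hL' x hx := hL _ (hL' x hx)
  add_mem' hL hL' x hx := S.add_mem (hL x hx) (hL' x hx)
  algebraMap_mem' c _ hx := S.smul_mem c hx

end Stabilizer

section Homogeneous
variable {σ R : Type*} [CommRing R] {m : ℕ}

theorem isHomogeneousMap_zero_iff {L : Module.End R (MvPolynomial σ R)} :
    IsHomogeneousMap 0 L ↔ ∀ k, L ∈ stabilizer (homogeneousSubmodule σ R k) :=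
  Iff.rfl

variable {L : Fin m → Module.End R (MvPolynomial σ R)}

theorem isHomogeneousMap_partialProd (h : ∀ i, IsHomogeneousMap 0 (L i)) (i : Fin (m + 1)) :
    IsHomogeneousMap 0 (Fin.partialProd L i) :=
  isHomogeneousMap_zero_iff.mpr fun k => partialProd_mem
    (S := (stabilizer _).toSubmonoid) (fun j => isHomogeneousMap_zero_iff.mp (h j) k) i

theorem isHomogeneousMap_tailProd (h : ∀ i, IsHomogeneousMap 0 (L i)) (i : Fin (m + 1)) :
    IsHomogeneousMap 0 (tailProd L i) :=
  isHomogeneousMap_zero_iff.mpr fun k => tailProd_mem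
    (S := (stabilizer _).toSubmonoid) (fun j => isHomogeneousMap_zero_iff.mp (h j) k) i

end Homogeneous

section DemazureLusztig
variable {σ R : Type*} [CommRing R]

theorem X_sub_X_ne_zero [Nontrivial R] {a b : σ} (hab : a ≠ b) :
    (X a - X b : MvPolynomial σ R) ≠ 0 :=
  sub_ne_zero.mpr fun h => hab (X_injective h)

theorem isHomogeneous_X_sub_X (a b : σ) : (X a - X b : MvPolynomial σ R).IsHomogeneous 1 :=
  (isHomogeneous_X R a).sub (isHomogeneous_X R b)

variable [DecidableEq σ]

theorem rename_swap_rename_swap (a b : σ) (f : MvPolynomial σ R) :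
    rename (Equiv.swap a b) (rename (Equiv.swap a b) f) = f := by
  rw [rename_rename, ← Equiv.Perm.coe_mul, Equiv.swap_mul_self, Equiv.Perm.coe_one, rename_id_apply]

theorem X_sub_X_dvd_sub_rename_swap (a b : σ) (f : MvPolynomial σ R) :
    X a - X b ∣ f - rename (Equiv.swap a b) f := by
  refine dvd_sub_algHom_apply (fun k => ?_) f
  rw [rename_X]
  obtain rfl | ha := eq_or_ne k a
  · rw [Equiv.swap_apply_left]
  · obtain rfl | hb := eq_or_ne k b
    · rw [Equiv.swap_apply_right, dvd_sub_comm]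
    · rw [Equiv.swap_apply_of_ne_of_ne ha hb, sub_self]
      exact dvd_zero _

variable [IsDomain R] {a b : σ}

/-- The divided difference operator `f ↦ (f - s f) / (x_a - x_b)`, where `s` exchanges `x_a` and
`x_b`. -/
def dividedDifference (hab : a ≠ b) : Module.End R (MvPolynomial σ R) where
  toFun f := (X_sub_X_dvd_sub_rename_swap a b f).choose
  map_add' f g := mul_left_cancel₀ (X_sub_X_ne_zero hab) <| by
    have h := fun f : MvPolynomial σ R => (X_sub_X_dvd_sub_rename_swap a b f).choose_spec
    rw [mul_add, ← h f, ← h g, ← h (f + g), map_add]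
    ring
  map_smul' c f := mul_left_cancel₀ (X_sub_X_ne_zero hab) <| by
    have h := fun f : MvPolynomial σ R => (X_sub_X_dvd_sub_rename_swap a b f).choose_spec
    rw [RingHom.id_apply, mul_smul_comm, ← h f, ← h (c • f), map_smul, smul_sub]

theorem X_sub_X_mul_dividedDifference (hab : a ≠ b) (f : MvPolynomial σ R) :
    (X a - X b) * dividedDifference hab f = f - rename (Equiv.swap a b) f :=
  (X_sub_X_dvd_sub_rename_swap a b f).choose_spec.symm

theorem dividedDifference_symm (hab : a ≠ b) (f : MvPolynomial σ R) :
    dividedDifference hab.symm f = -dividedDifference hab f := by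
  refine mul_left_cancel₀ (X_sub_X_ne_zero hab) ?_
  rw [mul_neg, X_sub_X_mul_dividedDifference, Equiv.swap_comm a b,
    ← X_sub_X_mul_dividedDifference hab.symm]
  ring

theorem dividedDifference_eq_zero_iff (hab : a ≠ b) {f : MvPolynomial σ R} :
    dividedDifference hab f = 0 ↔ rename (Equiv.swap a b) f = f := by
  rw [← mul_right_inj' (X_sub_X_ne_zero (R := R) hab), mul_zero, X_sub_X_mul_dividedDifference,
    sub_eq_zero, eq_comm (a := f)]

theorem rename_dividedDifference {ρ : Type*} [DecidableEq ρ] (e : σ ≃ ρ) {c d : ρ} (hab : a ≠ b)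
    (hcd : c ≠ d) (hc : e a = c) (hd : e b = d) (f : MvPolynomial σ R) :
    rename e (dividedDifference hab f) = dividedDifference hcd (rename e f) := by
  subst hc hd
  refine mul_left_cancel₀ (X_sub_X_ne_zero hcd) ?_
  have hswap : e ∘ Equiv.swap a b = Equiv.swap (e a) (e b) ∘ e :=
    funext fun k => e.injective.map_swap a b k
  have h := congrArg (rename e) (X_sub_X_mul_dividedDifference hab f)
  simp only [map_mul, map_sub, rename_X, rename_rename, hswap] at h
  rw [h, X_sub_X_mul_dividedDifference, rename_rename]

theorem rename_swap_dividedDifference (hab : a ≠ b) (f : MvPolynomial σ R) :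
    rename (Equiv.swap a b) (dividedDifference hab f) = dividedDifference hab f := by
  rw [rename_dividedDifference (Equiv.swap a b) hab hab.symm (by simp) (by simp),
    dividedDifference_symm hab, ← mul_right_inj' (X_sub_X_ne_zero (R := R) hab), mul_neg,
    X_sub_X_mul_dividedDifference, X_sub_X_mul_dividedDifference, rename_swap_rename_swap, neg_sub]

/-- The Demazure–Lusztig operator `T` of the variables `x_a` and `x_b`, which satisfies the Hecke
relation `(T - t) (T + 1) = 0`. -/
def demazureLusztig (t : R) (hab : a ≠ b) : Module.End R (MvPolynomial σ R) :=
  t • 1 + LinearMap.mulLeft R (C t * X b - X a) * dividedDifference hab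

/-- The operator `t T⁻¹ = T + 1 - t`, where `T` is the Demazure–Lusztig operator; no inverse of `t`
is required. -/
def demazureLusztigInv (t : R) (hab : a ≠ b) : Module.End R (MvPolynomial σ R) :=
  demazureLusztig t hab + (1 - t) • 1

theorem demazureLusztig_apply (t : R) (hab : a ≠ b) (f : MvPolynomial σ R) :
    demazureLusztig t hab f = C t * f + (C t * X b - X a) * dividedDifference hab f := by
  simp [demazureLusztig, smul_eq_C_mul]

theorem demazureLusztigInv_apply (t : R) (hab : a ≠ b) (f : MvPolynomial σ R) :
    demazureLusztigInv t hab f = demazureLusztig t hab f + (1 - C t) * f := by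
  simp [demazureLusztigInv, smul_eq_C_mul]

theorem X_sub_X_mul_demazureLusztig (t : R) (hab : a ≠ b) (f : MvPolynomial σ R) :
    (X a - X b) * demazureLusztig t hab f = (C t * (X a - X b)) * f +
      (C t * X b - X a) * (f - rename (Equiv.swap a b) f) := by
  rw [demazureLusztig_apply, ← X_sub_X_mul_dividedDifference hab]
  ring

theorem isHomogeneousMap_demazureLusztig (t : R) (hab : a ≠ b) :
    IsHomogeneousMap 0 (demazureLusztig (σ := σ) t hab) := by
  intro k f hf
  refine isHomogeneous_of_mul_left (isHomogeneous_X_sub_X a b) (X_sub_X_ne_zero hab) ?_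
  rw [X_sub_X_mul_demazureLusztig, add_zero, add_comm k 1]
  refine IsHomogeneous.add (IsHomogeneous.mul ?_ hf) (IsHomogeneous.mul ?_ ?_)
  · simpa using (isHomogeneous_C σ t).mul (isHomogeneous_X_sub_X a b)
  · exact (isHomogeneous_C_mul_X t b).sub (isHomogeneous_X R a)
  · exact hf.sub hf.rename_isHomogeneous

theorem demazureLusztig_apply_eq_smul_iff {t : R} (hab : a ≠ b) {f : MvPolynomial σ R} :
    demazureLusztig t hab f = t • f ↔ rename (Equiv.swap a b) f = f := by
  have hne : (C t * X b - X a : MvPolynomial σ R) ≠ 0 := fun h => by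
    simpa [hab] using congrArg (eval (Pi.single a 1)) h
  rw [demazureLusztig_apply, smul_eq_C_mul, add_eq_left, mul_eq_zero_iff_left hne,
    dividedDifference_eq_zero_iff]

theorem dividedDifference_demazureLusztig (t : R) (hab : a ≠ b) (f : MvPolynomial σ R) :
    dividedDifference hab (demazureLusztig t hab f) = -dividedDifference hab f := by
  refine mul_left_cancel₀ (X_sub_X_ne_zero hab) ?_
  rw [X_sub_X_mul_dividedDifference, demazureLusztig_apply, map_add, map_mul, map_mul, map_sub,
    map_mul, rename_swap_dividedDifference, rename_C, rename_X, rename_X, Equiv.swap_apply_left,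
    Equiv.swap_apply_right]
  linear_combination -(C t) * X_sub_X_mul_dividedDifference hab f

theorem demazureLusztigInv_mul_demazureLusztig (t : R) (hab : a ≠ b) :
    demazureLusztigInv t hab * demazureLusztig t hab =
      t • (1 : Module.End R (MvPolynomial σ R)) := by
  refine LinearMap.ext fun f => ?_
  rw [Module.End.mul_apply, demazureLusztigInv_apply,
    demazureLusztig_apply t hab (demazureLusztig t hab f), dividedDifference_demazureLusztig,
    demazureLusztig_apply, LinearMap.smul_apply, Module.End.one_apply, smul_eq_C_mul]
  ring

theorem demazureLusztig_mul_demazureLusztigInv (t : R) (hab : a ≠ b) :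
    demazureLusztig t hab * demazureLusztigInv t hab =
      t • (1 : Module.End R (MvPolynomial σ R)) := by
  rw [← demazureLusztigInv_mul_demazureLusztig t hab, demazureLusztigInv, mul_add, add_mul,
    mul_smul_one, smul_one_mul]

theorem demazureLusztig_X_mul (t : R) (hab : a ≠ b) (f : MvPolynomial σ R) :
    demazureLusztig t hab (X b * f) = X a * demazureLusztigInv t hab f := by
  refine mul_left_cancel₀ (X_sub_X_ne_zero hab) ?_
  rw [X_sub_X_mul_demazureLusztig, demazureLusztigInv_apply, map_mul, rename_X,
    Equiv.swap_apply_right]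
  linear_combination -(X a) * X_sub_X_mul_demazureLusztig t hab f

theorem rename_demazureLusztig {ρ : Type*} [DecidableEq ρ] (e : σ ≃ ρ) {c d : ρ} (t : R)
    (hab : a ≠ b) (hcd : c ≠ d) (hc : e a = c) (hd : e b = d) (f : MvPolynomial σ R) :
    rename e (demazureLusztig t hab f) = demazureLusztig t hcd (rename e f) := by
  simp only [demazureLusztig_apply, map_add, map_mul, map_sub, rename_C, rename_X, hc, hd,
    rename_dividedDifference e hab hcd hc hd]

theorem demazureLusztigInv_inv {F : Type*} [Field F] {t : F} (ht : t ≠ 0) (hab : a ≠ b)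
    (f : MvPolynomial σ F) :
    demazureLusztigInv t⁻¹ hab f = t⁻¹ • demazureLusztig t hab.symm f := by
  have hC : (C t⁻¹ * C t : MvPolynomial σ F) = 1 := by rw [← C_mul, inv_mul_cancel₀ ht, C_1]
  rw [demazureLusztigInv_apply, demazureLusztig_apply t⁻¹ hab, demazureLusztig_apply t hab.symm,
    dividedDifference_symm hab, smul_eq_C_mul]
  linear_combination -(f - X a * dividedDifference hab f) * hC

theorem eval_demazureLusztig_mul (t : R) (hab : a ≠ b) (x : σ → R) (f : MvPolynomial σ R) :
    (x a - x b) * eval x (demazureLusztig t hab f) = t * (x a - x b) * eval x f +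
      (t * x b - x a) * (eval x f - eval (x ∘ Equiv.swap a b) f) := by
  simpa [eval_rename] using congrArg (eval x) (X_sub_X_mul_demazureLusztig t hab f)

theorem eval_demazureLusztig_of_eq_mul {t : R} (hab : a ≠ b) {x : σ → R} (h : x a = t * x b)
    (f : MvPolynomial σ R) : eval x (demazureLusztig t hab f) = t * eval x f := by
  simp [demazureLusztig_apply, h]

theorem eval_demazureLusztig_of_eq_zero (t : R) (hab : a ≠ b) {x : σ → R} (h : x a = 0)
    (f : MvPolynomial σ R) :
    eval x (demazureLusztig t hab f) = t * eval (x ∘ Equiv.swap a b) f := by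
  have hswap : demazureLusztig t hab f = C t * rename (Equiv.swap a b) f +
      (C t - 1) * (X a * dividedDifference hab f) := by
    rw [demazureLusztig_apply]
    linear_combination -(C t) * X_sub_X_mul_dividedDifference hab f
  simp [hswap, eval_rename, h]

end DemazureLusztig

section HeckeGenerators
variable {R : Type*} [CommRing R] [IsDomain R] {m : ℕ}

/-- The adjacent transposition `sᵢ`. -/
abbrev adjacentSwap (i : Fin m) : Equiv.Perm (Fin (m + 1)) := Equiv.swap i.castSucc i.succ

theorem castSucc_ne_succ (i : Fin m) : i.castSucc ≠ i.succ := Fin.castSucc_lt_succ.ne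

/-- The Hecke algebra generator `Tᵢ`. -/
def heckeGenerator (t : R) (i : Fin m) : Module.End R (MvPolynomial (Fin (m + 1)) R) :=
  demazureLusztig t (castSucc_ne_succ i)

/-- The operator `t Tᵢ⁻¹`. -/
def heckeGeneratorInv (t : R) (i : Fin m) : Module.End R (MvPolynomial (Fin (m + 1)) R) :=
  demazureLusztigInv t (castSucc_ne_succ i)

theorem insertNth_comp_adjacentSwap {A : Type*} (c : A) (i : Fin m) (y : Fin m → A) :
    (Fin.insertNth i.castSucc c y : Fin (m + 1) → A) ∘ adjacentSwap i =
      Fin.insertNth i.succ c y := by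
  refine Fin.eq_insertNth_iff.mpr ⟨by simp, funext fun k => ?_⟩
  have hk : adjacentSwap i (i.succ.succAbove k) = i.castSucc.succAbove k := by
    rw [Equiv.swap_apply_def]
    simp only [Fin.succAbove, Fin.lt_def, Fin.ext_iff]
    grind
  simp only [Fin.removeNth, Function.comp_apply]
  rw [hk, Fin.insertNth_apply_succAbove]

theorem eval_insertNth_heckeGenerator (t : R) (i : Fin m) (y : Fin m → R)
    (f : MvPolynomial (Fin (m + 1)) R) :
    eval (Fin.insertNth i.castSucc 0 y : Fin (m + 1) → R) (heckeGenerator t i f) =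
      t * eval (Fin.insertNth i.succ 0 y : Fin (m + 1) → R) f := by
  have h : (Fin.insertNth i.castSucc 0 y : Fin (m + 1) → R) i.castSucc = 0 :=
    Fin.insertNth_apply_same _ _ _
  rw [heckeGenerator, eval_demazureLusztig_of_eq_zero _ _ h, insertNth_comp_adjacentSwap]

theorem eval_insertNth_partialProd (t : R) (i : Fin (m + 1)) (y : Fin m → R)
    (f : MvPolynomial (Fin (m + 1)) R) :
    eval (Fin.insertNth 0 0 y : Fin (m + 1) → R) (Fin.partialProd (heckeGenerator t) i f) =
      t ^ (i : ℕ) * eval (Fin.insertNth i 0 y : Fin (m + 1) → R) f := by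
  induction i using Fin.induction generalizing f with
  | zero => simp
  | succ i ih =>
    rw [Fin.partialProd_succ, Module.End.mul_apply, ih, eval_insertNth_heckeGenerator,
      Fin.val_succ, pow_succ, mul_assoc, Fin.val_castSucc]

theorem eval_insertNth_tailProd (t : R) (i : Fin (m + 1)) (y : Fin m → R)
    (f : MvPolynomial (Fin (m + 1)) R) :
    eval (Fin.insertNth i 0 y : Fin (m + 1) → R) (tailProd (heckeGenerator t) i f) =
      t ^ (m - i : ℕ) * eval (Fin.insertNth (Fin.last m) 0 y : Fin (m + 1) → R) f := by
  induction i using Fin.reverseInduction generalizing f with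
  | last => simp
  | cast i ih =>
    rw [tailProd_castSucc, Module.End.mul_apply, eval_insertNth_heckeGenerator, ih,
      val_sub_castSucc, pow_succ', mul_assoc]

theorem isHomogeneousMap_heckeGenerator (t : R) (i : Fin m) :
    IsHomogeneousMap 0 (heckeGenerator t i) :=
  isHomogeneousMap_demazureLusztig t (castSucc_ne_succ i)

end HeckeGenerators

section RaisingOperator
variable {F : Type*} [Field F] {m : ℕ}

/-- The affine raising operator `Φ : f ↦ (xₙ - t¹⁻ⁿ) f(xₙ / q, x₁, …, xₙ₋₁)`. -/
def raisingOperator (q t : F) : Module.End F (MvPolynomial (Fin (m + 1)) F) :=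
  LinearMap.mulLeft F (X (Fin.last m) - C (t⁻¹ ^ m)) ∘ₗ (cyclicShift q).toLinearMap

theorem raisingOperator_apply (q t : F) (f : MvPolynomial (Fin (m + 1)) F) :
    raisingOperator q t f = (X (Fin.last m) - C (t⁻¹ ^ m)) * cyclicShift q f := rfl

theorem eval_insertNth_raisingOperator (q t : F) (y : Fin m → F)
    (f : MvPolynomial (Fin (m + 1)) F) :
    eval (Fin.insertNth (Fin.last m) 0 y : Fin (m + 1) → F) (raisingOperator q t f) =
      -t⁻¹ ^ m * eval (Fin.insertNth 0 0 y : Fin (m + 1) → F) f := by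
  rw [raisingOperator_apply, map_mul, eval_cyclicShift]
  simp [Fin.insertNth_last', Fin.insertNth_zero']

theorem totalDegree_raisingOperator_le {q t : F} {f : MvPolynomial (Fin (m + 1)) F} {d : ℕ}
    (hf : f.totalDegree ≤ d) : (raisingOperator q t f).totalDegree ≤ d + 1 := by
  rw [raisingOperator_apply, add_comm d 1]
  refine (totalDegree_mul _ _).trans (add_le_add (totalDegree_X_sub_C _ _).le ?_)
  exact (isHomogeneousMap_cyclicShift q).totalDegree_le hf

/-- The operators `Zᵢ = Tᵢ ⋯ Tₙ₋₁ Φ T₁ ⋯ Tᵢ₋₁` of Knop and Sahi: up to the factor `xᵢ` and lower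
terms they are the inhomogeneous Cherednik operators, see `exists_X_mul_eq_add_cyclicRaising`. -/
def cyclicRaising (q t : F) (i : Fin (m + 1)) : Module.End F (MvPolynomial (Fin (m + 1)) F) :=
  tailProd (heckeGenerator t) i * raisingOperator q t * Fin.partialProd (heckeGenerator t) i

theorem totalDegree_cyclicRaising_le {q t : F} (i : Fin (m + 1))
    {f : MvPolynomial (Fin (m + 1)) F} {d : ℕ} (hf : f.totalDegree ≤ d) :
    (cyclicRaising q t i f).totalDegree ≤ d + 1 :=
  (isHomogeneousMap_tailProd (isHomogeneousMap_heckeGenerator t) i).totalDegree_le <|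
    totalDegree_raisingOperator_le <|
      (isHomogeneousMap_partialProd (isHomogeneousMap_heckeGenerator t) i).totalDegree_le hf

theorem X_dvd_of_eval_insertNth_eq_zero [Infinite F] {i : Fin (m + 1)}
    {f : MvPolynomial (Fin (m + 1)) F}
    (h : ∀ y : Fin m → F, eval (Fin.insertNth i 0 y : Fin (m + 1) → F) f = 0) : X i ∣ f := by
  have hdvd := dvd_sub_algHom_apply (φ := aeval (Fin.insertNth i 0 fun k => X (i.succAbove k)))
    (p := (X i : MvPolynomial (Fin (m + 1)) F))
    (fun k => by refine Fin.succAboveCases i ?_ (fun k => ?_) k <;> simp) f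
  have hzero : aeval (Fin.insertNth i 0 fun k => X (i.succAbove k)) f =
      (0 : MvPolynomial (Fin (m + 1)) F) := by
    refine MvPolynomial.funext fun x => ?_
    rw [eval_aeval_apply, map_zero, ← h fun k => x (i.succAbove k)]
    congr 2
    funext k
    refine Fin.succAboveCases i ?_ (fun k => ?_) k <;> simp
  rwa [hzero, sub_zero] at hdvd

theorem IsGeneric.infinite {q t : F} (h : IsGeneric q t) : Infinite F :=
  Infinite.of_injective (fun k : ℕ => q ^ k) fun a b hab =>
    (h.pow_mul_inv_pow_inj (b := 0) (b' := 0) (by simpa using hab)).1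

theorem exists_X_mul_eq_add_cyclicRaising [Infinite F] (q : F) {t : F} (ht : t ≠ 0)
    (i : Fin (m + 1)) (f : MvPolynomial (Fin (m + 1)) F) :
    ∃ g, f + cyclicRaising q t i f = X i * g := by
  refine X_dvd_of_eval_insertNth_eq_zero fun y => ?_
  have hpow : t ^ (m - i : ℕ) * (t⁻¹ ^ m * t ^ (i : ℕ)) = 1 := by
    rw [mul_left_comm, ← pow_add, Nat.sub_add_cancel (Fin.is_le i), inv_pow,
      inv_mul_cancel₀ (pow_ne_zero _ ht)]
  rw [map_add, cyclicRaising, Module.End.mul_apply, Module.End.mul_apply, eval_insertNth_tailProd,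
    eval_insertNth_raisingOperator, eval_insertNth_partialProd]
  linear_combination -(eval (Fin.insertNth i 0 y : Fin (m + 1) → F) f) * hpow

end RaisingOperator

section Vanishing
variable {m : ℕ}

theorem adjacentSwap_lt_adjacentSwap_iff {i : Fin m} {l k : Fin (m + 1)}
    (hlk : ¬(l = i.castSucc ∧ k = i.succ)) (hkl : ¬(l = i.succ ∧ k = i.castSucc)) :
    adjacentSwap i l < adjacentSwap i k ↔ l < k := by
  rw [Equiv.swap_apply_def, Equiv.swap_apply_def]
  simp only [Fin.lt_def, Fin.ext_iff, Fin.val_castSucc, Fin.val_succ] at *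
  grind

theorem descRank_comp_adjacentSwap {A : Type*} [LinearOrder A] {v : Fin (m + 1) → A} {i : Fin m}
    (h : v i.castSucc ≠ v i.succ) :
    descRank (v ∘ adjacentSwap i) = descRank v ∘ adjacentSwap i := by
  funext k
  rw [Function.comp_apply, descRank, descRank]
  refine Finset.card_equiv (adjacentSwap i) fun l => ?_
  simp only [Finset.mem_filter_univ, Function.comp_apply]
  refine or_congr Iff.rfl (and_congr_right fun he => (adjacentSwap_lt_adjacentSwap_iff ?_ ?_).symm)
  · rintro ⟨rfl, rfl⟩
    exact h (by simpa using he)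
  · rintro ⟨rfl, rfl⟩
    exact h (by simpa using he.symm)

theorem descRank_succ_of_eq {A : Type*} [LinearOrder A] {v : Fin (m + 1) → A} {i : Fin m}
    (h : v i.castSucc = v i.succ) : descRank v i.succ = descRank v i.castSucc + 1 := by
  rw [descRank, descRank, ← Finset.card_insert_of_notMem (a := i.castSucc) (by simp)]
  congr 1
  ext l
  simp only [Finset.mem_filter_univ, Finset.mem_insert, ← h, Fin.lt_def, Fin.ext_iff,
    Fin.val_castSucc, Fin.val_succ]
  have hl : (l : ℕ) = i → v i.castSucc = v l := fun hl => congrArg v (Fin.ext hl.symm)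
  grind

theorem size_comp_adjacentSwap (β : Fin (m + 1) → ℕ) (i : Fin m) :
    size (β ∘ adjacentSwap i) = size β :=
  Equiv.sum_comp (adjacentSwap i) β

variable {F : Type*} [Field F] {q t : F}

theorem spectralVector_comp_adjacentSwap {β : Fin (m + 1) → ℕ} {i : Fin m}
    (h : β i.castSucc ≠ β i.succ) :
    spectralVector q t (β ∘ adjacentSwap i) = spectralVector q t β ∘ adjacentSwap i := by
  funext k
  simp only [spectralVector, descRank_comp_adjacentSwap h, Function.comp_apply]

theorem spectralVector_castSucc_of_eq (ht : t ≠ 0) {β : Fin (m + 1) → ℕ} {i : Fin m}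
    (h : β i.castSucc = β i.succ) :
    spectralVector q t β i.castSucc = t * spectralVector q t β i.succ := by
  simp only [spectralVector, descRank_succ_of_eq h, h, pow_succ]
  field_simp

theorem sum_spectralVector_comp_adjacentSwap (β : Fin (m + 1) → ℕ) (i : Fin m) :
    ∑ k, spectralVector q t (β ∘ adjacentSwap i) k = ∑ k, spectralVector q t β k := by
  by_cases h : β i.castSucc = β i.succ
  · rw [Equiv.comp_swap_eq_update, h, Function.update_eq_self, ← h, Function.update_eq_self]
  · rw [spectralVector_comp_adjacentSwap h]
    exact Equiv.sum_comp (adjacentSwap i) (spectralVector q t β)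

/-- Stability of a set of compositions under adjacent exchanges. -/
def SwapClosed (J : Set (Fin (m + 1) → ℕ)) : Prop := ∀ β ∈ J, ∀ i, β ∘ adjacentSwap i ∈ J

theorem swapClosed_size (p : ℕ → Prop) : SwapClosed {β : Fin (m + 1) → ℕ | p (size β)} :=
  fun β hβ i => by simpa only [Set.mem_ofPred_eq, size_comp_adjacentSwap] using hβ

/-- The polynomials that vanish at the spectral vectors of the compositions in `J`. -/
def vanishingSubmodule {n : ℕ} (q t : F) (J : Set (Fin n → ℕ)) :
    Submodule F (MvPolynomial (Fin n) F) where
  carrier := {f | ∀ β ∈ J, eval (spectralVector q t β) f = 0}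
  zero_mem' _ _ := map_zero _
  add_mem' hf hg β hβ := by rw [map_add, hf β hβ, hg β hβ, add_zero]
  smul_mem' c f hf β hβ := by rw [smul_eval, hf β hβ, mul_zero]

theorem raisingOperator_mem_vanishingSubmodule (hq : q ≠ 0) {J J' : Set (Fin (m + 1) → ℕ)}
    (hJ : ∀ β, raise β ∈ J → β ∈ J') {f : MvPolynomial (Fin (m + 1)) F}
    (hf : f ∈ vanishingSubmodule q t J') : raisingOperator q t f ∈ vanishingSubmodule q t J := by
  intro β hβ
  rw [raisingOperator_apply, map_mul]
  by_cases h0 : β (Fin.last m) = 0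
  · have hβ' : β = Fin.snoc (fun k => β k.castSucc) 0 := by
      conv_lhs => rw [← Fin.snoc_init_self β, h0]
      rfl
    rw [hβ', spectralVector_snoc_zero]
    simp
  · obtain ⟨γ, rfl⟩ := exists_raise_eq h0
    have hγ : Fin.cons (q⁻¹ * (q * spectralVector q t γ 0)) (fun k => spectralVector q t γ k.succ) =
        spectralVector q t γ := by
      rw [inv_mul_cancel_left₀ hq]
      exact Fin.cons_self_tail _
    simp only [eval_cyclicShift, spectralVector_raise, Fin.snoc_last, Fin.snoc_castSucc, hγ,
      hf γ (hJ γ hβ), mul_zero]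

namespace IsGeneric

theorem heckeGenerator_mem_stabilizer (hg : IsGeneric q t) {J : Set (Fin (m + 1) → ℕ)}
    (hJ : SwapClosed J) (i : Fin m) :
    heckeGenerator t i ∈ stabilizer (vanishingSubmodule q t J) := by
  intro f hf β hβ
  by_cases h : β i.castSucc = β i.succ
  · rw [heckeGenerator,
      eval_demazureLusztig_of_eq_mul _ (spectralVector_castSucc_of_eq hg.t_ne_zero h), hf β hβ,
      mul_zero]
  · have heval := eval_demazureLusztig_mul t (castSucc_ne_succ i) (spectralVector q t β) f
    rw [← spectralVector_comp_adjacentSwap h, hf β hβ, hf _ (hJ β hβ i), mul_zero, sub_zero,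
      mul_zero, add_zero, mul_eq_zero, sub_eq_zero] at heval
    exact heval.resolve_left fun he => h (hg.spectralVector_apply_inj he).1

theorem cyclicRaising_mem_vanishingSubmodule (hg : IsGeneric q t)
    {J J' : Set (Fin (m + 1) → ℕ)} (hJ : SwapClosed J) (hJ' : SwapClosed J')
    (hr : ∀ β, raise β ∈ J → β ∈ J') (i : Fin (m + 1)) {f : MvPolynomial (Fin (m + 1)) F}
    (hf : f ∈ vanishingSubmodule q t J') :
    cyclicRaising q t i f ∈ vanishingSubmodule q t J :=
  tailProd_mem (S := (stabilizer _).toSubmonoid) (hg.heckeGenerator_mem_stabilizer hJ) i _ <|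
    raisingOperator_mem_vanishingSubmodule hg.q_ne_zero hr <|
      partialProd_mem (S := (stabilizer _).toSubmonoid)
        (hg.heckeGenerator_mem_stabilizer hJ') i _ hf

/-- The polynomial `g` is the image of `f` under the inhomogeneous Cherednik operator `Ξᵢ` of Knop
and Sahi. -/
theorem exists_inhomogeneousCherednik (hg : IsGeneric q t) {d : ℕ}
    {f : MvPolynomial (Fin (m + 1)) F} (hd : f.totalDegree ≤ d)
    (hf : f ∈ vanishingSubmodule q t {β | size β < d}) (i : Fin (m + 1)) :
    ∃ g, f + cyclicRaising q t i f = X i * g ∧ g.totalDegree ≤ d ∧ ∀ β, size β ≤ d →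
      eval (spectralVector q t β) g =
        (spectralVector q t β i)⁻¹ * eval (spectralVector q t β) f := by
  have := hg.infinite
  obtain ⟨g, hfg⟩ := exists_X_mul_eq_add_cyclicRaising q hg.t_ne_zero i f
  refine ⟨g, hfg, ?_, fun β hβ => ?_⟩
  · refine totalDegree_le_of_mul_left (X_ne_zero (R := F) i) ?_
    rw [← hfg, totalDegree_X, add_comm 1]
    exact (totalDegree_add _ _).trans
      (max_le (hd.trans d.le_succ) (totalDegree_cyclicRaising_le i hd))
  · have hvanish : cyclicRaising q t i f ∈ vanishingSubmodule q t {β | size β ≤ d} :=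
      hg.cyclicRaising_mem_vanishingSubmodule (swapClosed_size (· ≤ d)) (swapClosed_size (· < d))
        (fun γ hγ => by simpa only [Set.mem_ofPred_eq, size_raise, Nat.succ_le_iff] using hγ) i hf
    have heval := congrArg (eval (spectralVector q t β)) hfg
    rw [map_add, hvanish β hβ, add_zero, map_mul, eval_X] at heval
    rw [heval, inv_mul_cancel_left₀ (hg.spectralVector_ne_zero β i)]

end IsGeneric

end Vanishing

section InterpolationBasis
variable {F : Type*} [Field F] {n : ℕ} {q t : F}

/-- The interpolation polynomial of degree at most `|α|` whose values at the spectral vectors of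
compositions of size at most `|α|` are one at `α` and zero elsewhere. -/
def interpolationBasis (hg : IsGeneric q t) (α : Fin n → ℕ) : MvPolynomial (Fin n) F :=
  (hg.exists_eval_spectralVector_eq (size α) (Pi.single (M := fun _ => F) α 1)).choose

theorem totalDegree_interpolationBasis_le (hg : IsGeneric q t) (α : Fin n → ℕ) :
    (interpolationBasis hg α).totalDegree ≤ size α :=
  (hg.exists_eval_spectralVector_eq (size α) (Pi.single (M := fun _ => F) α 1)).choose_spec.1

theorem eval_interpolationBasis (hg : IsGeneric q t) {α β : Fin n → ℕ} (h : size β ≤ size α) :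
    eval (spectralVector q t β) (interpolationBasis hg α) = Pi.single (M := fun _ => F) α 1 β :=
  (hg.exists_eval_spectralVector_eq (size α) (Pi.single (M := fun _ => F) α 1)).choose_spec.2 β h

theorem eval_interpolationBasis_self (hg : IsGeneric q t) (α : Fin n → ℕ) :
    eval (spectralVector q t α) (interpolationBasis hg α) = 1 := by
  rw [eval_interpolationBasis hg le_rfl, Pi.single_eq_same]

theorem eval_interpolationBasis_of_ne (hg : IsGeneric q t) {α β : Fin n → ℕ}
    (h : size β ≤ size α) (hne : β ≠ α) :
    eval (spectralVector q t β) (interpolationBasis hg α) = 0 := by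
  rw [eval_interpolationBasis hg h, Pi.single_eq_of_ne hne]

theorem interpolationBasis_mem_vanishingSubmodule (hg : IsGeneric q t) (α : Fin n → ℕ) :
    interpolationBasis hg α ∈ vanishingSubmodule q t {β | size β < size α} := fun β hβ =>
  eval_interpolationBasis_of_ne hg (Nat.le_of_lt hβ) (by rintro rfl; exact lt_irrefl (size β) hβ)

theorem eq_smul_interpolationBasis (hg : IsGeneric q t) {α : Fin n → ℕ}
    {f : MvPolynomial (Fin n) F} (hd : f.totalDegree ≤ size α)
    (hf : ∀ β, size β ≤ size α → β ≠ α → eval (spectralVector q t β) f = 0) :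
    f = eval (spectralVector q t α) f • interpolationBasis hg α := by
  rw [← sub_eq_zero]
  refine hg.eq_zero_of_eval_spectralVector_eq_zero (d := size α)
    ((totalDegree_sub _ _).trans (max_le hd ((totalDegree_smul_le _ _).trans
      (totalDegree_interpolationBasis_le hg α)))) fun β hβ => ?_
  rw [map_sub, smul_eval]
  rcases eq_or_ne β α with rfl | hne
  · rw [eval_interpolationBasis_self, mul_one, sub_self]
  · rw [hf β hβ hne, eval_interpolationBasis_of_ne hg hβ hne, mul_zero, sub_zero]

end InterpolationBasis

section ExtraVanishing
variable {F : Type*} [Field F] {m : ℕ} {q t : F}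

theorem interpolationBasis_add_cyclicRaising (hg : IsGeneric q t) (α : Fin (m + 1) → ℕ)
    (i : Fin (m + 1)) :
    interpolationBasis hg α + cyclicRaising q t i (interpolationBasis hg α) =
      X i * ((spectralVector q t α i)⁻¹ • interpolationBasis hg α) := by
  obtain ⟨g, hfg, hd, heval⟩ := hg.exists_inhomogeneousCherednik
    (totalDegree_interpolationBasis_le hg α) (interpolationBasis_mem_vanishingSubmodule hg α) i
  rw [hfg, eq_smul_interpolationBasis hg hd fun β hβ hne => by
      rw [heval β hβ, eval_interpolationBasis_of_ne hg hβ hne, mul_zero],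
    heval α le_rfl, eval_interpolationBasis_self, mul_one]

/-- The relation `f + Zᵢ f = xᵢ f / yᵢ`, with `y` the spectral vector of `α`, transports vanishing
from the compositions in `I` of size below `d` to those of size `d`. -/
theorem interpolationBasis_mem_vanishingSubmodule_of_notMem (hg : IsGeneric q t)
    {I : Set (Fin (m + 1) → ℕ)} (hI : SwapClosed I) (hr : ∀ β, raise β ∈ I → β ∈ I)
    {α : Fin (m + 1) → ℕ} (hα : α ∉ I) :
    interpolationBasis hg α ∈ vanishingSubmodule q t I := by
  have swapClosed_lt (d : ℕ) : SwapClosed {β | β ∈ I ∧ size β < d} := fun β hβ i =>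
    ⟨hI β hβ.1 i, swapClosed_size (· < d) β hβ.2 i⟩
  have mem_of_size_lt (d : ℕ) :
      interpolationBasis hg α ∈ vanishingSubmodule q t {β | β ∈ I ∧ size β < d} := by
    induction d with
    | zero => exact fun β hβ => absurd hβ.2 (Nat.not_lt_zero _)
    | succ d ih =>
      intro β hβ
      obtain ⟨i, hi⟩ : ∃ i, α i ≠ β i := Function.ne_iff.mp fun h => hα (h ▸ hβ.1)
      have hraise : cyclicRaising q t i (interpolationBasis hg α) ∈
          vanishingSubmodule q t {β | β ∈ I ∧ size β < d + 1} :=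
        hg.cyclicRaising_mem_vanishingSubmodule (swapClosed_lt _) (swapClosed_lt d)
          (fun γ hγ => ⟨hr γ hγ.1, by simpa [size_raise] using hγ.2⟩) i ih
      have heval := congrArg (eval (spectralVector q t β))
        (interpolationBasis_add_cyclicRaising hg α i)
      rw [map_add, hraise β hβ, add_zero, map_mul, smul_eval, eval_X, ← mul_assoc] at heval
      by_contra h0
      have hone := (mul_eq_right₀ h0).mp heval.symm
      rw [mul_inv_eq_one₀ (hg.spectralVector_ne_zero _ _)] at hone
      exact hi (hg.spectralVector_apply_inj hone).1.symm
  exact fun β hβ => mem_of_size_lt (size β + 1) β ⟨hβ, Nat.lt_succ_self _⟩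

end ExtraVanishing

section ColumnLength
variable {n : ℕ}

/-- The length of the column `j` (counted from zero) of the diagram of `α`. -/
def columnLength (α : Fin n → ℕ) (j : ℕ) : ℕ := (Finset.univ.filter fun k => j < α k).card

theorem columnLength_eq_sum (α : Fin n → ℕ) (j : ℕ) :
    columnLength α j = ∑ k, if j < α k then 1 else 0 :=
  Finset.card_filter _ _

theorem columnLength_comp_equiv (α : Fin n → ℕ) (e : Equiv.Perm (Fin n)) (j : ℕ) :
    columnLength (α ∘ e) j = columnLength α j := by
  simp only [columnLength_eq_sum]
  exact Equiv.sum_comp e fun k => if j < α k then 1 else 0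

theorem columnLength_le_columnLength_raise (α : Fin (n + 1) → ℕ) (j : ℕ) :
    columnLength α j ≤ columnLength (raise α) j := by
  rw [columnLength_eq_sum, columnLength_eq_sum, Fin.sum_univ_succ, Fin.sum_univ_castSucc, add_comm]
  simp only [raise_castSucc, raise_last]
  refine Nat.add_le_add_left ?_ _
  split_ifs <;> omega

theorem columnLength_append {m : ℕ} (b : Fin n → ℕ) (c : Fin m → ℕ) (j : ℕ) :
    columnLength (Fin.append b c) j = columnLength b j + columnLength c j := by
  simp only [columnLength_eq_sum, Fin.sum_univ_add, Fin.append_left, Fin.append_right]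

theorem sum_sum_range_eq_sum_sum_filter {ι M : Type*} [Fintype ι] [AddCommMonoid M] {α : ι → ℕ}
    {d : ℕ} (hd : ∀ k, α k ≤ d) (f : ι → ℕ → M) :
    ∑ k, ∑ j ∈ Finset.range (α k), f k j = ∑ j ∈ Finset.range d, ∑ k with j < α k, f k j :=
  Finset.sum_comm' fun k j => by
    simpa using fun h : j < α k => h.trans_le (hd k)

theorem le_size (α : Fin n → ℕ) (k : Fin n) : α k ≤ size α :=
  Finset.single_le_sum (f := α) (fun _ _ => Nat.zero_le _) (Finset.mem_univ k)

theorem sum_columnLength (α : Fin n → ℕ) {d : ℕ} (hd : ∀ k, α k ≤ d) :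
    ∑ j ∈ Finset.range d, columnLength α j = size α := by
  simpa [columnLength, size] using (sum_sum_range_eq_sum_sum_filter (M := ℕ) hd fun _ _ => 1).symm

theorem descRank_const {A : Type*} [LinearOrder A] (a : A) (k : Fin n) :
    descRank (fun _ : Fin n => a) k = k := by
  have hfilter : (Finset.univ.filter fun l : Fin n => l < k) = Finset.Iio k := by
    ext
    simp
  simp [descRank, hfilter]

theorem descRank_append_left_of_lt {A : Type*} [LinearOrder A] {m : ℕ} {b : Fin n → A}
    {c : Fin m → A} (h : ∀ k l, b k < c l) (k : Fin n) :
    descRank (Fin.append b c) (Fin.castAdd m k) = m + descRank b k := by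
  have castAdd_lt (l : Fin n) : Fin.castAdd m l < Fin.castAdd m k ↔ l < k := Iff.rfl
  rw [descRank_eq_sum, Fin.sum_univ_add, add_comm, descRank_eq_sum]
  simp [h, castAdd_lt]

theorem descRank_append_right_of_lt {A : Type*} [LinearOrder A] {m : ℕ} {b : Fin n → A}
    {c : Fin m → A} (h : ∀ k l, b k < c l) (l : Fin m) :
    descRank (Fin.append b c) (Fin.natAdd n l) = descRank c l := by
  rw [descRank_eq_sum, Fin.sum_univ_add, descRank_eq_sum]
  simp [(h _ _).not_gt, (h _ _).ne']

theorem spectralVector_append_of_lt {F : Type*} [Field F] (q t : F) {m : ℕ} {b : Fin n → ℕ}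
    {c : Fin m → ℕ} (h : ∀ k l, b k < c l) :
    spectralVector q t (Fin.append b c) =
      Fin.append (fun k => t⁻¹ ^ m * spectralVector q t b k) (spectralVector q t c) := by
  funext k
  induction k using Fin.addCases with
  | left k => simp [spectralVector, descRank_append_left_of_lt h, pow_add, mul_left_comm]
  | right l => simp [spectralVector, descRank_append_right_of_lt h]

end ColumnLength

section Roots
variable {F : Type*} [Field F] {n : ℕ} {q t : F}

theorem eval_interpolationBasis_of_columnLength_lt (hg : IsGeneric q t) {α β : Fin n → ℕ} {j : ℕ}
    (h : columnLength β j < columnLength α j) :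
    eval (spectralVector q t β) (interpolationBasis hg α) = 0 := by
  cases n with
  | zero => simp [columnLength] at h
  | succ m =>
    exact interpolationBasis_mem_vanishingSubmodule_of_notMem hg
      (I := {γ | columnLength γ j ≤ columnLength β j})
      (fun γ hγ i => (columnLength_comp_equiv γ (adjacentSwap i) j).trans_le hγ)
      (fun γ hγ => (columnLength_le_columnLength_raise γ j).trans hγ) h.not_ge β
      (le_refl (columnLength β j))

theorem eval_interpolationBasis_snoc_zero (hg : IsGeneric q t) (α : Fin n → ℕ) (x : Fin n → F) :
    eval (Fin.snoc x (t⁻¹ ^ n)) (interpolationBasis hg (Fin.snoc α 0 : Fin (n + 1) → ℕ)) =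
      eval x (interpolationBasis hg α) := by
  have eval_subst (β : Fin n → ℕ) : eval (spectralVector q t β)
      (substLast (t⁻¹ ^ n) (interpolationBasis hg (Fin.snoc α 0 : Fin (n + 1) → ℕ))) =
        eval (spectralVector q t (Fin.snoc β 0 : Fin (n + 1) → ℕ))
          (interpolationBasis hg (Fin.snoc α 0 : Fin (n + 1) → ℕ)) := by
    rw [eval_substLast, spectralVector_snoc_zero]
  rw [← eval_substLast]
  congr 1
  rw [eq_smul_interpolationBasis hg (α := α)
    (f := substLast (t⁻¹ ^ n) (interpolationBasis hg (Fin.snoc α 0 : Fin (n + 1) → ℕ)))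
    ((totalDegree_substLast_le _ _).trans ((totalDegree_interpolationBasis_le hg _).trans_eq
      (size_snoc_zero α))) fun β hβ hne => by
        rw [eval_subst, eval_interpolationBasis_of_ne hg (by rwa [size_snoc_zero, size_snoc_zero])
          fun h => hne (Fin.snoc_left_injective _ h)],
    eval_subst, eval_interpolationBasis_self, one_smul]

theorem eval_interpolationBasis_append_zero (hg : IsGeneric q t) (α : Fin n → ℕ) (x : Fin n → F)
    (i : ℕ) :
    eval (Fin.append x fun l : Fin i => t⁻¹ ^ (n + (l : ℕ)))
      (interpolationBasis hg (Fin.append α fun _ : Fin i => 0)) =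
        eval x (interpolationBasis hg α) := by
  induction i with
  | zero =>
    rw [Fin.append_right_nil _ _ rfl, Fin.append_right_nil _ _ rfl]
    rfl
  | succ i ih =>
    have append_zero_succ : (Fin.append α fun _ : Fin (i + 1) => 0) =
        Fin.snoc (Fin.append α fun _ : Fin i => 0) 0 := by
      rw [← Fin.append_snoc]
      congr 1
      exact (Fin.snoc_init_self fun _ : Fin (i + 1) => 0).symm
    have append_pow_succ : (Fin.append x fun l : Fin (i + 1) => t⁻¹ ^ (n + (l : ℕ))) =
        Fin.snoc (Fin.append x fun l : Fin i => t⁻¹ ^ (n + (l : ℕ))) (t⁻¹ ^ (n + i)) := by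
      rw [← Fin.append_snoc]
      congr 1
      exact (Fin.snoc_init_self fun l : Fin (i + 1) => t⁻¹ ^ (n + (l : ℕ))).symm
    rw [append_zero_succ, append_pow_succ]
    exact (eval_interpolationBasis_snoc_zero hg _ _).trans ih

theorem eval_eq_zero_of_infinite {σ : Type*} (g : σ → Polynomial F) {f : MvPolynomial σ F}
    {s : Set F} (hs : s.Infinite) (hf : ∀ y ∈ s, eval (fun k => (g k).eval y) f = 0) (y : F) :
    eval (fun k => (g k).eval y) f = 0 := by
  have eval_aeval (y : F) : (aeval g f).eval y = eval (fun k => (g k).eval y) f := by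
    simpa [aeval_eq_eval] using comp_aeval_apply (f := g) (Polynomial.aeval y) f
  rw [← eval_aeval, Polynomial.eq_zero_of_infinite_isRoot (aeval g f) (hs.mono fun y hy => by
    rw [Set.mem_ofPred_eq, Polynomial.IsRoot, eval_aeval, hf y hy]), Polynomial.eval_zero]

/-- Append `i` zeros to `α`: the column condition makes the new polynomial vanish at the spectral
vectors of `(j, …, j, M, …, M)`, with `i` entries `M > j`, which determine it along a line. -/
theorem eval_interpolationBasis_of_lt_columnLength (hg : IsGeneric q t) {α : Fin n → ℕ} {i j : ℕ}
    (h : i < columnLength α j) :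
    eval (fun k : Fin n => q ^ j * t⁻¹ ^ i * t⁻¹ ^ (k : ℕ)) (interpolationBasis hg α) = 0 := by
  let g : Fin (n + i) → Polynomial F := Fin.append
    (fun k => Polynomial.C (q ^ j * t⁻¹ ^ i * t⁻¹ ^ (k : ℕ)))
    (fun l => Polynomial.X * Polynomial.C (t⁻¹ ^ (l : ℕ)))
  have eval_g (y : F) : (fun k => (g k).eval y) = Fin.append
      (fun k : Fin n => q ^ j * t⁻¹ ^ i * t⁻¹ ^ (k : ℕ)) fun l : Fin i => y * t⁻¹ ^ (l : ℕ) := by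
    funext k
    induction k using Fin.addCases with
    | left k => simp [g]
    | right l => simp [g, mul_comm y]
  have eval_eq_zero (y) (hy : y ∈ (q ^ ·) '' Set.Ioi j) : eval (fun k => (g k).eval y)
      (interpolationBasis hg (Fin.append α fun _ : Fin i => 0)) = 0 := by
    obtain ⟨M, hM : j < M, rfl⟩ := hy
    rw [← eval_interpolationBasis_of_columnLength_lt hg (α := Fin.append α fun _ : Fin i => 0)
      (β := Fin.append (fun _ : Fin n => j) fun _ : Fin i => M) (j := j)
      (by rw [columnLength_append, columnLength_append]; simpa [columnLength, hM] using h), eval_g,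
      spectralVector_append_of_lt q t fun _ _ => hM]
    congr 2
    funext k
    induction k using Fin.addCases <;>
      simp [spectralVector, descRank_const, mul_left_comm, mul_assoc]
  have infinite_powers : ((q ^ ·) '' Set.Ioi j).Infinite :=
    (Set.Ioi_infinite j).image fun a _ b _ hab =>
      (hg.pow_mul_inv_pow_inj (b := 0) (b' := 0) (by simpa using hab)).1
  have := eval_eq_zero_of_infinite g infinite_powers eval_eq_zero (t⁻¹ ^ n)
  rw [eval_g] at this
  simpa only [← pow_add, eval_interpolationBasis_append_zero] using this

end Roots

section LineRestriction

/-- The restriction of a polynomial to the line through the origin and `z`. -/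
def lineRestriction {σ R : Type*} [CommRing R] (z : σ → R) : MvPolynomial σ R →ₐ[R] Polynomial R :=
  aeval fun k => Polynomial.C (z k) * Polynomial.X

theorem aeval_lineRestriction {σ R A : Type*} [CommRing R] [CommRing A] [Algebra R A] (z : σ → R)
    (c : A) (f : MvPolynomial σ R) :
    Polynomial.aeval c (lineRestriction z f) = aeval (fun k => c * algebraMap R A (z k)) f := by
  rw [lineRestriction, comp_aeval_apply]
  simp [mul_comm c]

theorem coeff_lineRestriction {σ R : Type*} [CommRing R] (z : σ → R) (f : MvPolynomial σ R)
    (k : ℕ) :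
    (lineRestriction z f).coeff k = eval z (homogeneousComponent k f) := by
  induction f using MvPolynomial.induction_on' with
  | monomial u c =>
    have hline : lineRestriction z (monomial u c) =
        Polynomial.monomial u.degree (eval z (monomial u c)) := by
      rw [lineRestriction, aeval_monomial, eval_monomial]
      simp only [mul_pow, Finsupp.prod_mul, ← Polynomial.C_mul_X_pow_eq_monomial, map_mul,
        Polynomial.algebraMap_eq, mul_assoc]
      congr 1
      simp [Finsupp.prod, Finsupp.degree_apply, Finset.prod_pow_eq_pow_sum, map_prod]
    rw [hline, Polynomial.coeff_monomial, homogeneousComponent_of_mem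
      (isHomogeneous_monomial c rfl), apply_ite (eval z), map_zero]
    exact if_congr eq_comm rfl rfl
  | add p r hp hr => rw [map_add, Polynomial.coeff_add, hp, hr, map_add, map_add]

theorem eq_C_mul_nodal_of_natDegree_le {F ι : Type*} [Field F] {s : Finset ι} {v : ι → F}
    (hv : Set.InjOn v s) {p : Polynomial F} (hd : p.natDegree ≤ s.card)
    (hp : ∀ i ∈ s, p.eval (v i) = 0) :
    p = Polynomial.C (p.coeff s.card) * Lagrange.nodal s v := by
  refine Polynomial.eq_of_degree_sub_lt_of_eval_index_eq s hv ?_ fun i hi => ?_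
  · rw [Polynomial.degree_lt_iff_coeff_zero]
    intro k hk
    rw [Polynomial.coeff_sub, Polynomial.coeff_C_mul]
    rcases hk.eq_or_lt with rfl | hk
    · have := (Lagrange.nodal_monic (s := s) (v := v)).coeff_natDegree
      rw [Lagrange.natDegree_nodal] at this
      rw [this, mul_one, sub_self]
    · rw [Polynomial.coeff_eq_zero_of_natDegree_lt (p := p) (hd.trans_lt hk),
        Polynomial.coeff_eq_zero_of_natDegree_lt (p := Lagrange.nodal s v)
          (by rwa [Lagrange.natDegree_nodal]), mul_zero, sub_zero]
  · rw [hp i hi, Polynomial.eval_mul, Lagrange.eval_nodal_at_node hi, mul_zero]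

theorem aeval_eq_mul_prod_of_eval_eq_zero {F K : Type*} [Field F] [Field K] [Algebra F K] {n : ℕ}
    {q t : F} (hg : IsGeneric q t) {α : Fin n → ℕ} {f : MvPolynomial (Fin n) F}
    (hd : f.totalDegree ≤ size α)
    (hf : ∀ i j, i < columnLength α j →
      eval (fun k : Fin n => q ^ j * t⁻¹ ^ i * t⁻¹ ^ (k : ℕ)) f = 0) (c : K) :
    aeval (fun k : Fin n => c * algebraMap F K (t⁻¹ ^ (k : ℕ))) f =
      algebraMap F K
          (eval (fun k : Fin n => t⁻¹ ^ (k : ℕ)) (homogeneousComponent (size α) f)) *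
        ∏ j ∈ Finset.range (size α), ∏ i ∈ Finset.range (columnLength α j),
          (c - algebraMap F K (q ^ j * t⁻¹ ^ i)) := by
  let p := lineRestriction (fun k : Fin n => t⁻¹ ^ (k : ℕ)) f
  let v : (_ : ℕ) × ℕ → F := fun s => q ^ s.1 * t⁻¹ ^ s.2
  let s := (Finset.range (size α)).sigma fun j => Finset.range (columnLength α j)
  have card_s : s.card = size α := by
    rw [Finset.card_sigma]
    simp only [Finset.card_range]
    exact sum_columnLength α (le_size α)
  have v_injOn : Set.InjOn v s := by
    rintro ⟨j, i⟩ _ ⟨j', i'⟩ _ h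
    obtain ⟨rfl, rfl⟩ := hg.pow_mul_inv_pow_inj h
    rfl
  have natDegree_le : p.natDegree ≤ s.card := by
    rw [card_s, Polynomial.natDegree_le_iff_coeff_eq_zero]
    intro k hk
    rw [coeff_lineRestriction, homogeneousComponent_eq_zero _ _ (hd.trans_lt hk), map_zero]
  have eval_eq_zero (x) (hx : x ∈ s) : p.eval (v x) = 0 := by
    rw [← Polynomial.coe_aeval_eq_eval, aeval_lineRestriction, aeval_eq_eval]
    exact hf x.2 x.1 (Finset.mem_range.mp (Finset.mem_sigma.mp hx).2)
  rw [← aeval_lineRestriction,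
    show lineRestriction _ f = _ from eq_C_mul_nodal_of_natDegree_le v_injOn natDegree_le
      eval_eq_zero, card_s, coeff_lineRestriction, Lagrange.nodal]
  simp [s, v, Finset.prod_sigma]

end LineRestriction

section Cherednik
variable {F : Type*} [Field F] {m : ℕ} {q t : F}

theorem tailProd_heckeGenerator_X_last_mul (t : F) (i : Fin (m + 1))
    (f : MvPolynomial (Fin (m + 1)) F) :
    tailProd (heckeGenerator t) i (X (Fin.last m) * f) =
      X i * tailProd (heckeGeneratorInv t) i f := by
  induction i using Fin.reverseInduction with
  | last => simp
  | cast i ih =>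
    rw [tailProd_castSucc, tailProd_castSucc, Module.End.mul_apply, ih, heckeGenerator,
      demazureLusztig_X_mul]
    rfl

/-- The Cherednik operator `t^(n - i) Tᵢ⁻¹ ⋯ Tₙ₋₁⁻¹ ω T₁ ⋯ Tᵢ₋₁` (with variables numbered from `1`
to `n`), where `ω` is `cyclicShift`. -/
def cherednik (q t : F) (i : Fin (m + 1)) : Module.End F (MvPolynomial (Fin (m + 1)) F) :=
  tailProd (heckeGeneratorInv t) i * (cyclicShift q).toLinearMap *
    Fin.partialProd (heckeGenerator t) i

/-- The inverse of the Cherednik operator, multiplied by `t^(n - 1)`. -/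
def cherednikInv (q t : F) (i : Fin (m + 1)) : Module.End F (MvPolynomial (Fin (m + 1)) F) :=
  descProd (heckeGeneratorInv t) i * (cyclicShiftInv q).toLinearMap *
    descTailProd (heckeGenerator t) i

theorem cherednikInv_mul_cherednik (hq : q ≠ 0) (t : F) (i : Fin (m + 1)) :
    cherednikInv q t i * cherednik q t i =
      t ^ m • (1 : Module.End F (MvPolynomial (Fin (m + 1)) F)) := by
  have htail : descTailProd (heckeGenerator t) i * tailProd (heckeGeneratorInv t) i =
      t ^ (m - i : ℕ) • 1 := descTailProd_mul_tailProd
    (fun i : Fin m => demazureLusztig_mul_demazureLusztigInv t (castSucc_ne_succ i)) i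
  have hpartial : descProd (heckeGeneratorInv t) i * Fin.partialProd (heckeGenerator t) i =
      t ^ (i : ℕ) • 1 := descProd_mul_partialProd
    (fun i : Fin m => demazureLusztigInv_mul_demazureLusztig t (castSucc_ne_succ i)) i
  have hshift : (cyclicShiftInv q).toLinearMap * (cyclicShift q).toLinearMap =
      (1 : Module.End F (MvPolynomial (Fin (m + 1)) F)) :=
    LinearMap.ext (cyclicShiftInv_cyclicShift hq)
  calc cherednikInv q t i * cherednik q t i
      = descProd (heckeGeneratorInv t) i * ((cyclicShiftInv q).toLinearMap *
          (descTailProd (heckeGenerator t) i * tailProd (heckeGeneratorInv t) i) *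
          (cyclicShift q).toLinearMap) * Fin.partialProd (heckeGenerator t) i := by
        simp only [cherednikInv, cherednik, mul_assoc]
    _ = t ^ (m - i : ℕ) • (descProd (heckeGeneratorInv t) i *
          Fin.partialProd (heckeGenerator t) i) := by
        rw [htail, mul_smul_one, smul_mul_assoc, hshift, mul_smul_one, smul_mul_assoc]
    _ = t ^ m • 1 := by
        rw [hpartial, smul_smul, ← pow_add, Nat.sub_add_cancel i.is_le]

theorem homogeneousComponent_raisingOperator (q t : F) {f : MvPolynomial (Fin (m + 1)) F} {d : ℕ}
    (hd : f.totalDegree ≤ d) :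
    homogeneousComponent (d + 1) (raisingOperator q t f) =
      X (Fin.last m) * cyclicShift q (homogeneousComponent d f) := by
  have hshift := isHomogeneousMap_cyclicShift (n := m) q
  have hdeg : (cyclicShift q f).totalDegree ≤ d := hshift.totalDegree_le hd
  have hmul := (isHomogeneousMap_mulLeft (isHomogeneous_X F (Fin.last m)))
    |>.homogeneousComponent_apply (cyclicShift q f) d
  rw [LinearMap.mulLeft_apply, LinearMap.mulLeft_apply] at hmul
  have hcomp : homogeneousComponent d (cyclicShift q f) =
      cyclicShift q (homogeneousComponent d f) := hshift.homogeneousComponent_apply f d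
  rw [raisingOperator_apply, sub_mul, map_sub, homogeneousComponent_C_mul,
    homogeneousComponent_eq_zero (d + 1) (cyclicShift q f) (by omega), mul_zero, sub_zero, hmul,
    hcomp]

theorem homogeneousComponent_cyclicRaising (q t : F) (i : Fin (m + 1))
    {f : MvPolynomial (Fin (m + 1)) F} {d : ℕ} (hd : f.totalDegree ≤ d) :
    homogeneousComponent (d + 1) (cyclicRaising q t i f) =
      X i * cherednik q t i (homogeneousComponent d f) := by
  have hpartial := isHomogeneousMap_partialProd (isHomogeneousMap_heckeGenerator t) i
  have htail := (isHomogeneousMap_tailProd (isHomogeneousMap_heckeGenerator t) i)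
    |>.homogeneousComponent_apply
      (raisingOperator q t (Fin.partialProd (heckeGenerator t) i f)) (d + 1)
  have hcomp := hpartial.homogeneousComponent_apply f d
  rw [add_zero] at htail
  rw [cyclicRaising, Module.End.mul_apply, Module.End.mul_apply, htail,
    homogeneousComponent_raisingOperator q t (hpartial.totalDegree_le hd), hcomp,
    tailProd_heckeGenerator_X_last_mul]
  rfl

theorem homogeneousComponent_eq_cherednik {f g : MvPolynomial (Fin (m + 1)) F} {d : ℕ}
    (hd : f.totalDegree ≤ d) {i : Fin (m + 1)} (h : f + cyclicRaising q t i f = X i * g) :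
    homogeneousComponent d g = cherednik q t i (homogeneousComponent d f) := by
  have hmul : homogeneousComponent (d + 1) (X i * g) = X i * homogeneousComponent d g :=
    (isHomogeneousMap_mulLeft (isHomogeneous_X F i)).homogeneousComponent_apply g d
  refine mul_left_cancel₀ (X_ne_zero (R := F) i) ?_
  rw [← hmul, ← h, map_add, homogeneousComponent_eq_zero (d + 1) f (by omega), zero_add,
    homogeneousComponent_cyclicRaising q t i hd]

/-- The homogeneous part of top degree of an interpolation polynomial; it is a nonsymmetric
Macdonald polynomial. -/
def leadingPart {n : ℕ} (hg : IsGeneric q t) (α : Fin n → ℕ) : MvPolynomial (Fin n) F :=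
  homogeneousComponent (size α) (interpolationBasis hg α)

theorem cherednik_leadingPart (hg : IsGeneric q t) (α : Fin (m + 1) → ℕ) (i : Fin (m + 1)) :
    cherednik q t i (leadingPart hg α) = (spectralVector q t α i)⁻¹ • leadingPart hg α := by
  rw [leadingPart, ← homogeneousComponent_eq_cherednik (totalDegree_interpolationBasis_le hg α)
    (interpolationBasis_add_cyclicRaising hg α i), map_smul]

theorem cherednikInv_leadingPart (hg : IsGeneric q t) (α : Fin (m + 1) → ℕ) (i : Fin (m + 1)) :
    cherednikInv q t i (leadingPart hg α) =
      (t ^ m * spectralVector q t α i) • leadingPart hg α := by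
  have h := DFunLike.congr_fun (cherednikInv_mul_cherednik hg.q_ne_zero t i) (leadingPart hg α)
  rw [Module.End.mul_apply, cherednik_leadingPart, map_smul, LinearMap.smul_apply,
    Module.End.one_apply, inv_smul_eq_iff₀ (hg.spectralVector_ne_zero α i)] at h
  rw [h, smul_smul, mul_comm]

end Cherednik

section Symmetric
variable {F : Type*} [Field F] {m : ℕ} {q t : F}

theorem adjacentSwap_apply_zero {i : Fin m} (hi : 0 < (i : ℕ)) : adjacentSwap i 0 = 0 :=
  Equiv.swap_apply_of_ne_of_ne (fun h => hi.ne (congrArg Fin.val h)) (Fin.succ_ne_zero i).symm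

theorem rename_adjacentSwap_heckeGenerator (t : F) {i j : Fin m} (h : (i : ℕ) + 1 < j)
    (f : MvPolynomial (Fin (m + 1)) F) :
    rename (adjacentSwap j) (heckeGenerator t i f) =
      heckeGenerator t i (rename (adjacentSwap j) f) := by
  refine rename_demazureLusztig _ t _ _ (Equiv.swap_apply_of_ne_of_ne ?_ ?_)
    (Equiv.swap_apply_of_ne_of_ne ?_ ?_) f <;>
  · simp only [ne_eq, Fin.ext_iff, Fin.val_castSucc, Fin.val_succ]
    omega

theorem rename_adjacentSwap_descProd {f : MvPolynomial (Fin (m + 1)) F}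
    (hf : ∀ k : Fin m, 0 < (k : ℕ) → rename (adjacentSwap k) f = f) (j : Fin (m + 1)) (k : Fin m)
    (h : j < k.castSucc) :
    rename (adjacentSwap k) (descProd (heckeGenerator t) j f) =
      descProd (heckeGenerator t) j f := by
  induction j using Fin.induction with
  | zero => exact hf k h
  | succ j ih =>
    rw [descProd_succ, Module.End.mul_apply, rename_adjacentSwap_heckeGenerator t h,
      ih (Fin.castSucc_lt_succ.trans h)]

theorem sum_pow_smul_descProd_heckeGeneratorInv (ht : t ≠ 0) {f : MvPolynomial (Fin (m + 1)) F}
    (hf : ∀ k : Fin m, 0 < (k : ℕ) → rename (adjacentSwap k) f = f) :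
    ∑ k : Fin (m + 1), t⁻¹ ^ (k : ℕ) • descProd (heckeGeneratorInv t) k f =
      t⁻¹ ^ m • ∑ k, descProd (heckeGenerator t) k f :=
  sum_pow_smul_eq_of_eq_add_smul_sum ht <| descProd_add_smul_one_apply fun j k h =>
    (demazureLusztig_apply_eq_smul_iff (castSucc_ne_succ k)).mpr
      (rename_adjacentSwap_descProd hf j k h)

theorem isSymmetric_of_rename_adjacentSwap {f : MvPolynomial (Fin (m + 1)) F}
    (hf : ∀ i : Fin m, rename (adjacentSwap i) f = f) : f.IsSymmetric := fun e => by
  have he : e ∈ Submonoid.closure (Set.range fun i : Fin m => adjacentSwap i) := by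
    rw [Equiv.Perm.mclosure_swap_castSucc_succ]
    trivial
  induction he using Submonoid.closure_induction with
  | mem e he => obtain ⟨i, rfl⟩ := he; exact hf i
  | one => simp
  | mul e e' _ _ he he' => rw [Equiv.Perm.coe_mul, ← rename_rename, he', he]

theorem cyclicShiftInv_of_isSymmetric (q : F) {f : MvPolynomial (Fin (m + 1)) F}
    (hf : f.IsSymmetric) : cyclicShiftInv q f = aeval (Function.update X 0 (C q * X 0)) f := by
  rw [cyclicShiftInv]
  nth_rw 2 [← hf (finRotate (m + 1))]
  rw [aeval_rename]
  congr 2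
  funext k
  induction k using Fin.lastCases with
  | last => simp
  | cast k =>
    rw [Fin.snoc_castSucc, Function.comp_apply, finRotate_apply, Fin.coeSucc_eq_succ,
      Function.update_of_ne (Fin.succ_ne_zero k)]

theorem rename_cyclicShiftInv_of_isSymmetric (q : F) {f : MvPolynomial (Fin (m + 1)) F}
    (hf : f.IsSymmetric) {e : Equiv.Perm (Fin (m + 1))} (he : e 0 = 0) :
    rename e (cyclicShiftInv q f) = cyclicShiftInv q f := by
  rw [cyclicShiftInv_of_isSymmetric q hf]
  nth_rw 2 [← hf e]
  rw [aeval_rename, ← AlgHom.comp_apply, comp_aeval]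
  congr 2
  funext k
  obtain rfl | hk := eq_or_ne k 0
  · simp [he]
  · have hek : e k ≠ 0 := fun h => hk (e.injective (h.trans he.symm))
    simp [hk, hek]

theorem cherednikInv_of_isSymmetric (q t : F) {f : MvPolynomial (Fin (m + 1)) F}
    (hf : f.IsSymmetric) (i : Fin (m + 1)) :
    cherednikInv q t i f =
      t ^ (m - i : ℕ) • descProd (heckeGeneratorInv t) i (cyclicShiftInv q f) := by
  have h := descTailProd_apply_of_forall_eq_smul (L := heckeGenerator t)
    (fun k : Fin m => (demazureLusztig_apply_eq_smul_iff (castSucc_ne_succ k)).mpr (hf _)) i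
  rw [cherednikInv, Module.End.mul_apply, Module.End.mul_apply, h, map_smul, map_smul]
  rfl

theorem sum_cherednikInv_of_isSymmetric (q : F) (ht : t ≠ 0) {f : MvPolynomial (Fin (m + 1)) F}
    (hf : f.IsSymmetric) :
    ∑ i, cherednikInv q t i f = ∑ i, descProd (heckeGenerator t) i (cyclicShiftInv q f) := by
  have hpow (i : Fin (m + 1)) : t ^ (m - i : ℕ) = t ^ m * t⁻¹ ^ (i : ℕ) := by
    rw [inv_pow, pow_sub₀ t ht i.is_le]
  simp only [cherednikInv_of_isSymmetric q t hf, hpow, mul_smul]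
  rw [← Finset.smul_sum, sum_pow_smul_descProd_heckeGeneratorInv ht fun k hk =>
      rename_cyclicShiftInv_of_isSymmetric q hf (adjacentSwap_apply_zero hk),
    smul_smul, ← mul_pow, mul_inv_cancel₀ ht, one_pow, one_smul]

theorem rename_rev_heckeGeneratorInv_inv (ht : t ≠ 0) (i : Fin m)
    (f : MvPolynomial (Fin (m + 1)) F) :
    rename Fin.rev (heckeGeneratorInv t⁻¹ i f) =
      t⁻¹ • heckeGenerator t i.rev (rename Fin.rev f) := by
  rw [heckeGeneratorInv, demazureLusztigInv_inv ht, map_smul]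
  exact congrArg (t⁻¹ • ·) <|
    rename_demazureLusztig Fin.revPerm t _ _ (Fin.rev_succ i) (Fin.rev_castSucc i) f

theorem rename_rev_cyclicShift_inv (q : F) (f : MvPolynomial (Fin (m + 1)) F) :
    rename Fin.rev (cyclicShift q⁻¹ f) = cyclicShiftInv q (rename Fin.rev f) := by
  have h : (rename Fin.rev).comp (cyclicShift q⁻¹) =
      (cyclicShiftInv (n := m) q).comp (rename Fin.rev) := by
    refine algHom_ext fun k => ?_
    induction k using Fin.cases with
    | zero => simp
    | succ k => simp [Fin.rev_castSucc, Fin.rev_succ]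
  exact DFunLike.congr_fun h f

theorem rename_rev_tailProd_heckeGeneratorInv_inv (ht : t ≠ 0) (i : Fin (m + 1))
    (f : MvPolynomial (Fin (m + 1)) F) :
    rename Fin.rev (tailProd (heckeGeneratorInv t⁻¹) i f) =
      t⁻¹ ^ (m - i : ℕ) • descProd (heckeGenerator t) i.rev (rename Fin.rev f) := by
  induction i using Fin.reverseInduction with
  | last => simp
  | cast i ih =>
    rw [tailProd_castSucc, Module.End.mul_apply, rename_rev_heckeGeneratorInv_inv ht, ih, map_smul,
      smul_smul, ← pow_succ', val_sub_castSucc, Fin.rev_castSucc, descProd_succ, Fin.rev_succ,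
      Module.End.mul_apply]

theorem rename_rev_cherednik_inv_of_isSymmetric (q : F) (ht : t ≠ 0)
    {f : MvPolynomial (Fin (m + 1)) F} (hf : f.IsSymmetric) (i : Fin (m + 1)) :
    rename Fin.rev (cherednik q⁻¹ t⁻¹ i f) =
      t⁻¹ ^ m • descProd (heckeGenerator t) i.rev (cyclicShiftInv q f) := by
  have hpartial := partialProd_apply_of_forall_eq_smul (L := heckeGenerator t⁻¹)
    (fun k : Fin m => (demazureLusztig_apply_eq_smul_iff (castSucc_ne_succ k)).mpr (hf _)) i
  have hrev : rename Fin.rev f = f := hf Fin.revPerm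
  have hshift : (cyclicShift q⁻¹).toLinearMap (t⁻¹ ^ (i : ℕ) • f) =
      t⁻¹ ^ (i : ℕ) • cyclicShift q⁻¹ f := map_smul _ _ _
  rw [cherednik, Module.End.mul_apply, Module.End.mul_apply, hpartial, hshift, map_smul, map_smul,
    rename_rev_tailProd_heckeGeneratorInv_inv ht, rename_rev_cyclicShift_inv, hrev, smul_smul,
    ← pow_add, Nat.add_sub_cancel' i.is_le]

theorem rename_rev_sum_cherednik_inv_of_isSymmetric (q : F) (ht : t ≠ 0)
    {f : MvPolynomial (Fin (m + 1)) F} (hf : f.IsSymmetric) :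
    rename Fin.rev (∑ i, cherednik q⁻¹ t⁻¹ i f) = t⁻¹ ^ m • ∑ i, cherednikInv q t i f := by
  simp only [map_sum, rename_rev_cherednik_inv_of_isSymmetric q ht hf]
  rw [← Finset.smul_sum, sum_cherednikInv_of_isSymmetric q ht hf]
  exact congrArg (t⁻¹ ^ m • ·) <| Equiv.sum_comp Fin.revPerm
    fun i => descProd (heckeGenerator t) i (cyclicShiftInv q f)

end Symmetric

section Lift
variable {F : Type*} [Field F] {n : ℕ} {q t : F}

namespace IsGeneric

theorem eq_of_homogeneousComponent_eq_of_eval_eq (hg : IsGeneric q t) {d : ℕ}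
    {f g : MvPolynomial (Fin n) F} (hf : f.totalDegree ≤ d) (hgd : g.totalDegree ≤ d)
    (htop : homogeneousComponent d f = homogeneousComponent d g)
    (h : ∀ β, size β < d → eval (spectralVector q t β) f = eval (spectralVector q t β) g) :
    f = g := by
  rw [← sub_eq_zero]
  have hd : (f - g).totalDegree ≤ d := (totalDegree_sub _ _).trans (max_le hf hgd)
  have hzero : homogeneousComponent d (f - g) = 0 := by rw [map_sub, htop, sub_self]
  cases d with
  | zero =>
    rw [← hzero, homogeneousComponent_zero]
    exact totalDegree_eq_zero_iff_eq_C.mp (Nat.le_zero.mp hd)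
  | succ d =>
    refine hg.eq_zero_of_eval_spectralVector_eq_zero
      (totalDegree_le_of_homogeneousComponent_succ_eq_zero hd hzero) fun β hβ => ?_
    rw [map_sub, h β (Nat.lt_succ_of_le hβ), sub_self]

theorem exists_vanishing_of_homogeneousComponent_eq (hg : IsGeneric q t) {d : ℕ}
    {p : MvPolynomial (Fin n) F} (hp : p.IsHomogeneous d) :
    ∃ f : MvPolynomial (Fin n) F, f.totalDegree ≤ d ∧ homogeneousComponent d f = p ∧
      f ∈ vanishingSubmodule q t {β | size β < d} := by
  have htop : homogeneousComponent d p = p := by rw [homogeneousComponent_of_mem hp, if_pos rfl]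
  cases d with
  | zero => exact ⟨p, hp.totalDegree_le, htop, fun β hβ => absurd hβ (Nat.not_lt_zero _)⟩
  | succ d =>
    obtain ⟨f, hf, heval⟩ :=
      hg.exists_eval_spectralVector_eq d fun β => eval (spectralVector q t β) p
    refine ⟨p - f, (totalDegree_sub _ _).trans (max_le hp.totalDegree_le (by omega)), ?_,
      fun β hβ => ?_⟩
    · rw [map_sub, htop, homogeneousComponent_eq_zero _ f (by omega), sub_zero]
    · rw [map_sub, heval β (Nat.lt_succ_iff.mp hβ), sub_self]

end IsGeneric

variable {d : ℕ} {O : Finset (Fin n → ℕ)}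

theorem eq_sum_smul_interpolationBasis (hg : IsGeneric q t) (hO : ∀ β ∈ O, size β = d)
    {f : MvPolynomial (Fin n) F} (hd : f.totalDegree ≤ d)
    (hf : ∀ β, size β ≤ d → β ∉ O → eval (spectralVector q t β) f = 0) :
    f = ∑ β ∈ O, eval (spectralVector q t β) f • interpolationBasis hg β := by
  classical
  rw [← sub_eq_zero]
  refine hg.eq_zero_of_eval_spectralVector_eq_zero (d := d)
    ((totalDegree_sub _ _).trans (max_le hd <| totalDegree_finsetSum_le fun β hβ =>
      (totalDegree_smul_le _ _).trans <|
        hO β hβ ▸ totalDegree_interpolationBasis_le hg β)) fun γ hγ => ?_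
  have hterm (β) (hβ : β ∈ O) :
      eval (spectralVector q t γ) (eval (spectralVector q t β) f • interpolationBasis hg β) =
        if γ = β then eval (spectralVector q t γ) f else 0 := by
    rw [smul_eval, eval_interpolationBasis hg (hγ.trans_eq (hO β hβ).symm), Pi.single_apply]
    split_ifs with h
    · rw [h, mul_one]
    · rw [mul_zero]
  rw [map_sub, map_sum, Finset.sum_congr rfl hterm, Finset.sum_ite_eq, sub_eq_zero]
  split_ifs with h
  · rfl
  · exact hf γ hγ h

theorem mem_span_interpolationBasis_iff (hg : IsGeneric q t) (hO : ∀ β ∈ O, size β = d)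
    {f : MvPolynomial (Fin n) F} :
    f ∈ Submodule.span F (interpolationBasis hg '' O) ↔
      f.totalDegree ≤ d ∧ ∀ β, size β ≤ d → β ∉ O → eval (spectralVector q t β) f = 0 := by
  constructor
  · intro hf
    suffices h : Submodule.span F (interpolationBasis hg '' O) ≤ restrictTotalDegree (Fin n) F d ⊓
        vanishingSubmodule q t {β | size β ≤ d ∧ β ∉ O} from
      ⟨(mem_restrictTotalDegree _ _ _).mp (h hf).1, fun β hβ hβO => (h hf).2 β ⟨hβ, hβO⟩⟩
    rw [Submodule.span_le]
    rintro _ ⟨γ, hγ, rfl⟩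
    refine ⟨(mem_restrictTotalDegree _ _ _).mpr
      (hO γ hγ ▸ totalDegree_interpolationBasis_le hg γ), fun β hβ => ?_⟩
    exact eval_interpolationBasis_of_ne hg (hβ.1.trans_eq (hO γ hγ).symm)
      fun h => hβ.2 (h ▸ hγ)
  · rintro ⟨hd, hf⟩
    rw [eq_sum_smul_interpolationBasis hg hO hd hf]
    exact Submodule.sum_mem _ fun β hβ =>
      Submodule.smul_mem _ _ (Submodule.subset_span ⟨β, hβ, rfl⟩)

/-- The span of the nonsymmetric Macdonald polynomials indexed by `O`. -/
def leadingSpan (hg : IsGeneric q t) (O : Finset (Fin n → ℕ)) :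
    Submodule F (MvPolynomial (Fin n) F) :=
  Submodule.span F (leadingPart hg '' O)

theorem mem_leadingSpan_iff (hg : IsGeneric q t) (hO : ∀ β ∈ O, size β = d)
    {p : MvPolynomial (Fin n) F} :
    p ∈ leadingSpan hg O ↔ ∃ f, (f.totalDegree ≤ d ∧
      ∀ β, size β ≤ d → β ∉ O → eval (spectralVector q t β) f = 0) ∧
        homogeneousComponent d f = p := by
  have himage : leadingPart hg '' (O : Set (Fin n → ℕ)) =
      homogeneousComponent d '' (interpolationBasis hg '' (O : Set (Fin n → ℕ))) := by
    rw [Set.image_image]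
    exact Set.image_congr fun β hβ => by rw [leadingPart, hO β hβ]
  rw [leadingSpan, himage, ← Submodule.map_span, Submodule.mem_map]
  exact exists_congr fun f => and_congr_left fun _ => mem_span_interpolationBasis_iff hg hO

end Lift

section LeadingSpan
variable {F : Type*} [Field F] {m d : ℕ} {q t : F} {O : Finset (Fin (m + 1) → ℕ)}

theorem SwapClosed.compl {J : Set (Fin (m + 1) → ℕ)} (hJ : SwapClosed J) : SwapClosed Jᶜ := by
  intro β hβ i h
  have hβ' := hJ _ h i
  rw [Function.comp_assoc, ← Equiv.Perm.coe_mul, Equiv.swap_mul_self, Equiv.Perm.coe_one,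
    Function.comp_id] at hβ'
  exact hβ hβ'

theorem SwapClosed.inter {J J' : Set (Fin (m + 1) → ℕ)} (hJ : SwapClosed J)
    (hJ' : SwapClosed J') : SwapClosed (J ∩ J') :=
  fun β hβ i => ⟨hJ β hβ.1 i, hJ' β hβ.2 i⟩

theorem heckeGenerator_mem_stabilizer_leadingSpan (hg : IsGeneric q t)
    (hO : ∀ β ∈ O, size β = d) (hswap : SwapClosed (O : Set (Fin (m + 1) → ℕ))) (i : Fin m) :
    heckeGenerator t i ∈ stabilizer (leadingSpan hg O) := by
  intro p hp
  obtain ⟨f, ⟨hd, hf⟩, rfl⟩ := (mem_leadingSpan_iff hg hO).mp hp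
  have hT := isHomogeneousMap_heckeGenerator t i
  have hmem := hg.heckeGenerator_mem_stabilizer ((swapClosed_size (· ≤ d)).inter hswap.compl) i f
    fun β hβ => hf β hβ.1 hβ.2
  exact (mem_leadingSpan_iff hg hO).mpr ⟨heckeGenerator t i f,
    ⟨hT.totalDegree_le hd, fun β hβ hβO => hmem β ⟨hβ, hβO⟩⟩, hT.homogeneousComponent_apply f d⟩

theorem cyclicShift_mem_stabilizer_leadingSpan (hg : IsGeneric q t)
    (hT : ∀ i, heckeGenerator t i ∈ stabilizer (leadingSpan hg O)) :
    (cyclicShift q).toLinearMap ∈ stabilizer (leadingSpan hg O) := by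
  have hcancel := descTailProd_mul_tailProd
    (fun i : Fin m => demazureLusztig_mul_demazureLusztigInv t (castSucc_ne_succ i)) 0
  suffices h : leadingSpan hg O ≤ (leadingSpan hg O).comap (cyclicShift q).toLinearMap from h
  rw [leadingSpan, Submodule.span_le, ← leadingSpan]
  rintro _ ⟨β, hβ, rfl⟩
  have hshift : t ^ m • cyclicShift q (leadingPart hg β) = (spectralVector q t β 0)⁻¹ •
      descTailProd (heckeGenerator t) 0 (leadingPart hg β) := by
    rw [← map_smul (descTailProd (heckeGenerator t) 0), ← cherednik_leadingPart]
    exact (DFunLike.congr_fun hcancel (cyclicShift q (leadingPart hg β))).symm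
  refine ((leadingSpan hg O).smul_mem_iff (pow_ne_zero m hg.t_ne_zero)).mp ?_
  rw [AlgHom.toLinearMap_apply, hshift]
  exact Submodule.smul_mem _ _ (descTailProd_mem (S := (stabilizer _).toSubmonoid) hT 0 _
    (Submodule.subset_span ⟨β, hβ, rfl⟩))

theorem mem_leadingSpan_of_sum_cherednik_eq_smul (hg : IsGeneric q t) (hO : ∀ β ∈ O, size β = d)
    {p : MvPolynomial (Fin (m + 1)) F} (hp : p.IsHomogeneous d) {e : F}
    (he : ∑ i, cherednik q t i p = e • p)
    (hmem : ∀ β, size β = d → ∑ i, (spectralVector q t β i)⁻¹ = e → β ∈ O) :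
    p ∈ leadingSpan hg O := by
  obtain ⟨f, hd, rfl, hf⟩ := hg.exists_vanishing_of_homogeneousComponent_eq hp
  choose g hfg hgd heval using hg.exists_inhomogeneousCherednik hd hf
  have hsum : ∑ i, g i = e • f := by
    refine hg.eq_of_homogeneousComponent_eq_of_eval_eq (totalDegree_finsetSum_le fun i _ => hgd i)
      ((totalDegree_smul_le _ _).trans hd) ?_ fun β hβ => ?_
    · rw [map_sum, map_smul, ← he]
      exact Finset.sum_congr rfl fun i _ => homogeneousComponent_eq_cherednik hd (hfg i)
    · simp only [map_sum, smul_eval, heval _ β hβ.le, hf β hβ, mul_zero, Finset.sum_const_zero]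
  refine (mem_leadingSpan_iff hg hO).mpr ⟨f, ⟨hd, fun β hβ hβO => ?_⟩, rfl⟩
  obtain hlt | heq := hβ.lt_or_eq
  · exact hf β hlt
  · have hβe := congrArg (eval (spectralVector q t β)) hsum
    simp only [map_sum, smul_eval, heval _ β hβ, ← Finset.sum_mul] at hβe
    by_contra hne
    exact hβO (hmem β heq (mul_right_cancel₀ hne hβe))

end LeadingSpan

theorem mem_of_sum_mem_of_forall_eq_smul {F M ι κ : Type*} [Field F] [AddCommGroup M] [Module F M]
    {S : Submodule F M} {Y : ι → Module.End F M} (hY : ∀ i, Y i ∈ stabilizer S) {χ : κ → ι → F}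
    {k₀ : κ} {s : Finset κ} (hχ : ∀ k ∈ s, χ k ≠ χ k₀) (v : κ → M)
    (hv₀ : ∀ i, Y i (v k₀) = χ k₀ i • v k₀)
    (hv : ∀ k ∈ s, ∀ i, Y i (v k) = χ k i • v k) (h : v k₀ + ∑ k ∈ s, v k ∈ S) : v k₀ ∈ S := by
  classical
  induction s using Finset.induction_on generalizing v with
  | empty => simpa using h
  | insert k₁ s hk₁ ih =>
    obtain ⟨i, hi⟩ := Function.ne_iff.mp (hχ k₁ (Finset.mem_insert_self k₁ s))
    have hscaled : (χ k₀ i - χ k₁ i) • v k₀ ∈ S := by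
      refine ih (fun k hk => hχ k (Finset.mem_insert_of_mem hk))
        (fun k => (χ k i - χ k₁ i) • v k) (fun j => ?_) (fun k hk j => ?_) ?_
      · rw [map_smul, hv₀, smul_comm]
      · rw [map_smul, hv k (Finset.mem_insert_of_mem hk), smul_comm]
      · have hsub := S.sub_mem (hY i _ h) (S.smul_mem (χ k₁ i) h)
        convert hsub using 1
        rw [Finset.sum_insert hk₁, map_add, map_add, map_sum, hv₀,
          hv k₁ (Finset.mem_insert_self _ _),
          Finset.sum_congr rfl fun k hk => hv k (Finset.mem_insert_of_mem hk) i]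
        simp only [sub_smul, Finset.sum_sub_distrib, smul_add, Finset.smul_sum]
        abel
    exact (S.smul_mem_iff (sub_ne_zero.mpr hi.symm)).mp hscaled

section Reversal
variable {F : Type*} [Field F] {m : ℕ} {q t : F}

theorem rename_rev_rename_rev {n : ℕ} {R : Type*} [CommSemiring R] (f : MvPolynomial (Fin n) R) :
    rename Fin.rev (rename Fin.rev f) = f := by
  rw [rename_rename, Fin.rev_involutive.comp_self, rename_id_apply]

theorem heckeGeneratorInv_mem {A : Subalgebra F (Module.End F (MvPolynomial (Fin (m + 1)) F))}
    {i : Fin m} (h : heckeGenerator t i ∈ A) : heckeGeneratorInv t i ∈ A :=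
  A.add_mem h (A.smul_mem A.one_mem (1 - t))

theorem cherednikInv_mem {A : Subalgebra F (Module.End F (MvPolynomial (Fin (m + 1)) F))}
    (hT : ∀ i, heckeGenerator t i ∈ A) (hω : (cyclicShiftInv q).toLinearMap ∈ A)
    (i : Fin (m + 1)) : cherednikInv q t i ∈ A :=
  A.mul_mem (A.mul_mem
    (descProd_mem (S := A.toSubmonoid) (fun i => heckeGeneratorInv_mem (hT i)) i) hω)
    (descTailProd_mem (S := A.toSubmonoid) hT i)

variable {S : Submodule F (MvPolynomial (Fin (m + 1)) F)}

theorem heckeGenerator_mem_stabilizer_comap_rev (ht : t ≠ 0)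
    (hS : ∀ i, heckeGenerator t⁻¹ i ∈ stabilizer S) (i : Fin m) :
    heckeGenerator t i ∈ stabilizer (S.comap (rename Fin.rev).toLinearMap) := by
  intro p hp
  have h := congrArg (rename Fin.rev)
    (rename_rev_heckeGeneratorInv_inv ht i.rev (rename Fin.rev p))
  rw [rename_rev_rename_rev, rename_rev_rename_rev, Fin.rev_rev, map_smul] at h
  refine (S.smul_mem_iff (inv_ne_zero ht)).mp ?_
  rw [AlgHom.toLinearMap_apply, ← h]
  exact heckeGeneratorInv_mem (hS i.rev) _ hp

theorem cyclicShiftInv_mem_stabilizer_comap_rev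
    (hS : (cyclicShift q⁻¹).toLinearMap ∈ stabilizer S) :
    (cyclicShiftInv q).toLinearMap ∈ stabilizer (S.comap (rename Fin.rev).toLinearMap) := by
  intro p hp
  have h := congrArg (rename Fin.rev) (rename_rev_cyclicShift_inv q (rename Fin.rev p))
  rw [rename_rev_rename_rev, rename_rev_rename_rev] at h
  rw [Submodule.mem_comap, AlgHom.toLinearMap_apply, AlgHom.toLinearMap_apply, ← h]
  exact hS _ hp

end Reversal

section SpectralOrbit
variable {F : Type*} [Field F] {n m d : ℕ} {q t : F}

theorem spectralVector_inv (q t : F) (β : Fin n → ℕ) (i : Fin n) :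
    spectralVector q⁻¹ t⁻¹ β i = (spectralVector q t β i)⁻¹ := by
  simp only [spectralVector, mul_inv, inv_pow]

open Classical in
/-- The compositions whose size and sum of the entries of the spectral vector agree with those of
`α`. When `q` and `t` are algebraically independent they are the rearrangements of `α`. -/
def spectralOrbit (q t : F) (α : Fin n → ℕ) : Finset (Fin n → ℕ) :=
  {β ∈ Finset.piAntidiag Finset.univ (size α) |
    ∑ k, spectralVector q t β k = ∑ k, spectralVector q t α k}

theorem mem_spectralOrbit {α β : Fin n → ℕ} :
    β ∈ spectralOrbit q t α ↔
      size β = size α ∧ ∑ k, spectralVector q t β k = ∑ k, spectralVector q t α k := by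
  simp [spectralOrbit, size]

theorem size_of_mem_spectralOrbit {α β : Fin n → ℕ} (hβ : β ∈ spectralOrbit q t α) :
    size β = size α :=
  (mem_spectralOrbit.mp hβ).1

theorem swapClosed_spectralOrbit (q t : F) (α : Fin (m + 1) → ℕ) :
    SwapClosed (spectralOrbit q t α : Set (Fin (m + 1) → ℕ)) := by
  intro β hβ i
  rw [Finset.mem_coe, mem_spectralOrbit] at hβ ⊢
  rwa [size_comp_adjacentSwap, sum_spectralVector_comp_adjacentSwap]

theorem heckeGenerator_sum_interpolationBasis (hg : IsGeneric q t)
    {O : Finset (Fin (m + 1) → ℕ)} (hO : ∀ β ∈ O, size β = d)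
    (hswap : SwapClosed (O : Set (Fin (m + 1) → ℕ))) (i : Fin m) :
    heckeGenerator t i (∑ β ∈ O, interpolationBasis hg β) =
      t • ∑ β ∈ O, interpolationBasis hg β := by
  classical
  set R := ∑ β ∈ O, interpolationBasis hg β with hR
  have hd : R.totalDegree ≤ d := totalDegree_finsetSum_le fun β hβ =>
    hO β hβ ▸ totalDegree_interpolationBasis_le hg β
  have heval (γ) (hγ : size γ ≤ d) :
      eval (spectralVector q t γ) R = if γ ∈ O then 1 else 0 := by
    rw [hR, map_sum, Finset.sum_congr rfl fun β hβ =>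
      eval_interpolationBasis hg (hγ.trans_eq (hO β hβ).symm)]
    simp only [Pi.single_apply, Finset.sum_ite_eq]
  have hmem (γ) : γ ∘ adjacentSwap i ∈ O ↔ γ ∈ O :=
    ⟨fun h => by_contra fun hγ => hswap.compl γ hγ i h, fun h => hswap γ h i⟩
  have hTd : (heckeGenerator t i R).totalDegree ≤ d :=
    (isHomogeneousMap_heckeGenerator t i).totalDegree_le hd
  rw [← sub_eq_zero]
  refine hg.eq_zero_of_eval_spectralVector_eq_zero ((totalDegree_sub _ _).trans
    (max_le hTd ((totalDegree_smul_le _ _).trans hd))) fun γ hγ => ?_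
  rw [map_sub, smul_eval, sub_eq_zero]
  by_cases h : γ i.castSucc = γ i.succ
  · exact eval_demazureLusztig_of_eq_mul (castSucc_ne_succ i)
      (spectralVector_castSucc_of_eq hg.t_ne_zero h) R
  · have hmul := eval_demazureLusztig_mul t (castSucc_ne_succ i) (spectralVector q t γ) R
    have hinv : eval (spectralVector q t γ ∘ adjacentSwap i) R =
        eval (spectralVector q t γ) R := by
      rw [← spectralVector_comp_adjacentSwap h, heval _ ((size_comp_adjacentSwap γ i).trans_le hγ),
        heval γ hγ]
      simp only [hmem]
    rw [hinv, sub_self, mul_zero, add_zero, mul_comm t, mul_assoc] at hmul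
    exact mul_left_cancel₀
      (sub_ne_zero.mpr fun he => h (hg.spectralVector_apply_inj he).1) hmul

theorem isSymmetric_sum_leadingPart (hg : IsGeneric q t)
    {O : Finset (Fin (m + 1) → ℕ)} (hO : ∀ β ∈ O, size β = d)
    (hswap : SwapClosed (O : Set (Fin (m + 1) → ℕ))) :
    (∑ β ∈ O, leadingPart hg β).IsSymmetric := by
  have hlead : ∑ β ∈ O, leadingPart hg β =
      homogeneousComponent d (∑ β ∈ O, interpolationBasis hg β) := by
    rw [map_sum]
    exact Finset.sum_congr rfl fun β hβ => by rw [leadingPart, hO β hβ]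
  rw [hlead]
  refine isSymmetric_of_rename_adjacentSwap fun i => ?_
  have hfix := (demazureLusztig_apply_eq_smul_iff (castSucc_ne_succ i)).mp
    (heckeGenerator_sum_interpolationBasis hg hO hswap i)
  rw [rename_homogeneousComponent, hfix]

theorem sum_cherednikInv_sum_leadingPart (hg : IsGeneric q t) {O : Finset (Fin (m + 1) → ℕ)} {e : F}
    (hO : ∀ β ∈ O, ∑ k, spectralVector q t β k = e) :
    ∑ i, cherednikInv q t i (∑ β ∈ O, leadingPart hg β) =
      (t ^ m * e) • ∑ β ∈ O, leadingPart hg β := by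
  simp only [map_sum, cherednikInv_leadingPart]
  rw [Finset.sum_comm, Finset.smul_sum]
  refine Finset.sum_congr rfl fun β hβ => ?_
  rw [← Finset.sum_smul, ← Finset.mul_sum, hO β hβ]

theorem sum_leadingPart_mem_leadingSpan_inv (hg : IsGeneric q t) (α : Fin (m + 1) → ℕ) :
    ∑ β ∈ spectralOrbit q t α, leadingPart hg β ∈ leadingSpan hg.inv (spectralOrbit q t α) := by
  have hsize : ∀ β ∈ spectralOrbit q t α, size β = size α := fun _ => size_of_mem_spectralOrbit
  have hsymm := isSymmetric_sum_leadingPart hg hsize (swapClosed_spectralOrbit q t α)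
  have hrev := rename_rev_sum_cherednik_inv_of_isSymmetric q hg.t_ne_zero hsymm
  rw [sum_cherednikInv_sum_leadingPart hg fun β hβ => (mem_spectralOrbit.mp hβ).2, smul_smul,
    ← mul_assoc, inv_pow, inv_mul_cancel₀ (pow_ne_zero m hg.t_ne_zero), one_mul] at hrev
  have heigen := congrArg (rename Fin.rev) hrev
  rw [rename_rev_rename_rev, map_smul,
    show rename Fin.rev _ = ∑ β ∈ spectralOrbit q t α, leadingPart hg β from
      hsymm Fin.revPerm] at heigen
  refine mem_leadingSpan_of_sum_cherednik_eq_smul hg.inv hsize ?_ heigen fun β hβ he => ?_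
  · exact IsHomogeneous.sum _ _ _ fun β hβ =>
      hsize β hβ ▸ homogeneousComponent_isHomogeneous _ _
  · simp only [spectralVector_inv, inv_inv] at he
    exact mem_spectralOrbit.mpr ⟨hβ, he⟩

theorem rename_rev_leadingPart_mem (hg : IsGeneric q t) (α : Fin (m + 1) → ℕ) :
    rename Fin.rev (leadingPart hg α) ∈ leadingSpan hg.inv (spectralOrbit q t α) := by
  classical
  have hsize : ∀ β ∈ spectralOrbit q t α, size β = size α := fun _ => size_of_mem_spectralOrbit
  have hswap := swapClosed_spectralOrbit q t α
  set S := leadingSpan hg.inv (spectralOrbit q t α)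
  have hT : ∀ i, heckeGenerator t⁻¹ i ∈ stabilizer S :=
    heckeGenerator_mem_stabilizer_leadingSpan hg.inv hsize hswap
  have hY : ∀ i, cherednikInv q t i ∈ stabilizer (S.comap (rename Fin.rev).toLinearMap) :=
    cherednikInv_mem (heckeGenerator_mem_stabilizer_comap_rev hg.t_ne_zero hT)
      (cyclicShiftInv_mem_stabilizer_comap_rev (cyclicShift_mem_stabilizer_leadingSpan hg.inv hT))
  have hsum : leadingPart hg α + ∑ β ∈ (spectralOrbit q t α).erase α, leadingPart hg β ∈
      S.comap (rename Fin.rev).toLinearMap := by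
    rw [Finset.add_sum_erase _ _ (mem_spectralOrbit.mpr ⟨rfl, rfl⟩), Submodule.mem_comap,
      AlgHom.toLinearMap_apply,
      show rename Fin.rev _ = ∑ β ∈ spectralOrbit q t α, leadingPart hg β from
        isSymmetric_sum_leadingPart hg hsize hswap Fin.revPerm]
    exact sum_leadingPart_mem_leadingSpan_inv hg α
  refine mem_of_sum_mem_of_forall_eq_smul hY (χ := fun β i => t ^ m * spectralVector q t β i)
    (fun β hβ h => Finset.ne_of_mem_erase hβ <| funext fun i => ?_) (leadingPart hg)
    (cherednikInv_leadingPart hg α) (fun β _ => cherednikInv_leadingPart hg β) hsum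
  exact (hg.spectralVector_apply_inj
    (mul_left_cancel₀ (pow_ne_zero m hg.t_ne_zero) (congrFun h i))).1

theorem eval_eq_zero_of_rename_rev_leadingPart (hg : IsGeneric q t) {α : Fin n → ℕ}
    (hsep : ∀ β : Fin n → ℕ, ∑ k, spectralVector q t β k = ∑ k, spectralVector q t α k →
      columnLength β = columnLength α)
    {f : MvPolynomial (Fin n) F} {c : F} (hd : f.totalDegree ≤ size α)
    (htop : homogeneousComponent (size α) f = c • rename Fin.rev (leadingPart hg α))
    (hf : ∀ β, size β < size α → eval (spectralVector q⁻¹ t⁻¹ β) f = 0) {i j : ℕ}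
    (h : i < columnLength α j) :
    eval (fun k : Fin n => q⁻¹ ^ j * t⁻¹⁻¹ ^ i * t⁻¹⁻¹ ^ (k : ℕ)) f = 0 := by
  cases n with
  | zero => simp [columnLength] at h
  | succ m =>
    have hsize : ∀ β ∈ spectralOrbit q t α, size β = size α := fun _ => size_of_mem_spectralOrbit
    obtain ⟨g, ⟨hgd, hgv⟩, hgtop⟩ := (mem_leadingSpan_iff hg.inv hsize).mp
      (Submodule.smul_mem _ c (rename_rev_leadingPart_mem hg α))
    have hfg : f = g := hg.inv.eq_of_homogeneousComponent_eq_of_eval_eq hd hgd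
      (htop.trans hgtop.symm) fun β hβ => by
        rw [hf β hβ, hgv β hβ.le fun hO => hβ.ne (hsize β hO)]
    rw [hfg, eq_sum_smul_interpolationBasis hg.inv hsize hgd hgv, map_sum]
    refine Finset.sum_eq_zero fun β hβ => ?_
    rw [← hsep β (mem_spectralOrbit.mp hβ).2] at h
    rw [smul_eval, eval_interpolationBasis_of_lt_columnLength hg.inv h, mul_zero]

end SpectralOrbit

section Diagram
open InterpolationMacdonald (leg legSum armSum plus)
variable {n : ℕ}

theorem sum_Icc_one_eq_sum_range (a : ℕ) (f : ℕ → ℕ) :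
    ∑ j ∈ Finset.Icc 1 a, f j = ∑ j ∈ Finset.range a, f (j + 1) := by
  rw [Finset.range_eq_Ico, Finset.sum_Ico_add' f 0 a 1]
  rfl

theorem sum_card_filter_lt {ι : Type*} [LinearOrder ι] (s : Finset ι) :
    ∑ k ∈ s, (s.filter (k < ·)).card = ∑ i ∈ Finset.range s.card, i := by
  induction s using Finset.induction_on_min with
  | empty => rfl
  | insert m s hm ih =>
    have hms : m ∉ s := fun h => lt_irrefl m (hm m h)
    rw [Finset.sum_insert hms, Finset.card_insert_of_notMem hms, Finset.sum_range_succ, ← ih,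
      add_comm]
    congr 1
    · refine Finset.sum_congr rfl fun k hk => ?_
      rw [Finset.filter_insert, if_neg (hm k hk).not_gt]
    · rw [Finset.filter_insert, if_neg (lt_irrefl m), Finset.filter_true_of_mem hm]

theorem armSum_eq_sum_columnLength (α : Fin n → ℕ) :
    armSum α = ∑ j ∈ Finset.range (size α), j * columnLength α j := by
  have sum_arm (k : Fin n) :
      ∑ j ∈ Finset.Icc 1 (α k), (α k - j) = ∑ j ∈ Finset.range (α k), j := by
    rw [sum_Icc_one_eq_sum_range, ← Finset.sum_range_reflect (fun j => j)]
    exact Finset.sum_congr rfl fun j _ => by rw [Nat.sub_sub, add_comm 1 j]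
  rw [armSum, Finset.sum_congr rfl fun k _ => sum_arm k,
    sum_sum_range_eq_sum_sum_filter (le_size α)]
  simp only [Finset.sum_const, smul_eq_mul, mul_comm, columnLength]

theorem leg_add_one_of_antitone {α : Fin n → ℕ} (hα : Antitone α) {i : Fin n} {j : ℕ} :
    leg α i (j + 1) = ((Finset.univ.filter fun k => j < α k).filter (i < ·)).card := by
  have hlower : (Finset.univ.filter fun k => k < i ∧ j + 1 ≤ α k + 1 ∧ α k + 1 ≤ α i) = ∅ :=
    Finset.filter_eq_empty_iff.mpr fun k _ hk => (hα hk.1.le).not_gt hk.2.2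
  rw [leg, hlower, Finset.card_empty, add_zero, Finset.filter_filter]
  congr 1
  ext k
  simp only [Finset.mem_filter, Finset.mem_univ, true_and]
  exact ⟨fun h => ⟨h.2.1, h.1⟩, fun h => ⟨h.2, h.1, hα h.2.le⟩⟩

theorem legSum_eq_sum_columnLength {α : Fin n → ℕ} (hα : Antitone α) :
    legSum α = ∑ j ∈ Finset.range (size α), ∑ i ∈ Finset.range (columnLength α j), i := by
  simp only [legSum, sum_Icc_one_eq_sum_range, leg_add_one_of_antitone hα]
  rw [sum_sum_range_eq_sum_sum_filter (le_size α)]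
  exact Finset.sum_congr rfl fun j _ => sum_card_filter_lt _

theorem legSum_plus_eq_sum_columnLength (α : Fin n → ℕ) :
    legSum (plus α) =
      ∑ j ∈ Finset.range (size α), ∑ i ∈ Finset.range (columnLength α j), i := by
  let e := Tuple.sort fun k => OrderDual.toDual (α k)
  have plus_antitone : Antitone (plus α) := fun _ _ h =>
    Tuple.monotone_sort (fun k => OrderDual.toDual (α k)) h
  have size_plus : size (plus α) = size α := Equiv.sum_comp e α
  rw [legSum_eq_sum_columnLength plus_antitone, size_plus]
  exact Finset.sum_congr rfl fun j _ => by rw [← columnLength_comp_equiv α e j]; rfl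

theorem prod_columns_const {M : Type*} [CommMonoid M] (c : M) (α : Fin n → ℕ) :
    ∏ j ∈ Finset.range (size α), ∏ _i ∈ Finset.range (columnLength α j), c = c ^ size α := by
  simp only [Finset.prod_const, Finset.card_range]
  rw [Finset.prod_pow_eq_pow_sum, sum_columnLength α (le_size α)]

theorem prod_columns_pow_mul_pow {M : Type*} [CommMonoid M] (x y : M) (α : Fin n → ℕ) :
    ∏ j ∈ Finset.range (size α), ∏ i ∈ Finset.range (columnLength α j), x ^ j * y ^ i =
      x ^ armSum α * y ^ legSum (plus α) := by
  simp only [armSum_eq_sum_columnLength, legSum_plus_eq_sum_columnLength,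
    ← Finset.prod_pow_eq_pow_sum, Finset.prod_mul_distrib, Finset.prod_const, Finset.card_range,
    pow_mul]

theorem prod_columns_inv_sub_inv {K : Type*} [Field K] (α : Fin n → ℕ) {x : K} (hx : x ≠ 0)
    {r : ℕ → ℕ → K} (hr : ∀ j i, r j i ≠ 0) :
    ∏ j ∈ Finset.range (size α), ∏ i ∈ Finset.range (columnLength α j), (x⁻¹ - (r j i)⁻¹) =
      ((-1) ^ size α *
        ∏ j ∈ Finset.range (size α), ∏ i ∈ Finset.range (columnLength α j), r j i)⁻¹ *
        x⁻¹ ^ size α *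
        ∏ j ∈ Finset.range (size α), ∏ i ∈ Finset.range (columnLength α j), (x - r j i) := by
  simp only [← prod_columns_const, ← Finset.prod_inv_distrib, ← Finset.prod_mul_distrib]
  refine Finset.prod_congr rfl fun j _ => Finset.prod_congr rfl fun i _ => ?_
  have := hr j i
  field_simp
  ring

end Diagram

section AlgebraicIndependence
variable {R F : Type*} [CommRing R] [Field F] [Algebra R F] {q t : F} {n : ℕ}

theorem aeval_monomial_pair (q t : F) (u : Fin 2 →₀ ℕ) :
    aeval ![q, t] (monomial u (1 : R)) = q ^ u 0 * t ^ u 1 := by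
  rw [aeval_monomial, map_one, one_mul, Finsupp.prod_fintype _ _ fun _ => pow_zero _,
    Fin.prod_univ_two]
  rfl

theorem isGeneric_of_algebraicIndependent (h : AlgebraicIndependent R ![q, t]) :
    IsGeneric q t := by
  have : Nontrivial R := (algebraMap R F).domain_nontrivial
  have hq : q ≠ 0 := h.ne_zero 0
  have ht : t ≠ 0 := h.ne_zero 1
  refine ⟨hq, ht, fun x y hxy => ?_⟩
  have hpow : q ^ x.toNat * t ^ y.toNat = q ^ (-x).toNat * t ^ (-y).toNat := by
    have hx : x = x.toNat - (-x).toNat := by omega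
    have hy : y = y.toNat - (-y).toNat := by omega
    rw [hx, hy, zpow_sub₀ hq, zpow_sub₀ ht, div_mul_div_comm, div_eq_one_iff_eq
      (mul_ne_zero (zpow_ne_zero _ hq) (zpow_ne_zero _ ht))] at hxy
    simpa only [zpow_natCast] using hxy
  let u (a b : ℕ) : Fin 2 →₀ ℕ := Finsupp.equivFunOnFinite.symm ![a, b]
  have aeval_u (a b : ℕ) : aeval ![q, t] (monomial (u a b) (1 : R)) = q ^ a * t ^ b :=
    aeval_monomial_pair q t _
  have hu : u x.toNat y.toNat = u (-x).toNat (-y).toNat :=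
    monomial_left_injective (one_ne_zero (α := R)) <| h <|
      (aeval_u _ _).trans (hpow.trans (aeval_u _ _).symm)
  have hx : x.toNat = (-x).toNat := DFunLike.congr_fun hu 0
  have hy : y.toNat = (-y).toNat := DFunLike.congr_fun hu 1
  omega

theorem descRank_injective {A : Type*} [LinearOrder A] (v : Fin n → A) :
    Function.Injective (descRank v) := by
  have descRank_lt {i j : Fin n} (h : v j < v i ∨ (v j = v i ∧ i < j)) :
      descRank v i < descRank v j := by
    refine Finset.card_lt_card (Finset.ssubset_iff_of_subset (fun k => ?_) |>.mpr ⟨i, ?_⟩)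
    · simp only [Finset.mem_filter, Finset.mem_univ, true_and]
      grind
    · simpa using h
  intro i j hij
  by_contra hne
  rcases lt_trichotomy (v i) (v j) with h | h | h
  · exact (descRank_lt (.inl h)).ne' hij
  · rcases lt_or_gt_of_ne hne with hlt | hlt
    · exact (descRank_lt (.inr ⟨h.symm, hlt⟩)).ne hij
    · exact (descRank_lt (.inr ⟨h, hlt⟩)).ne' hij
  · exact (descRank_lt (.inl h)).ne hij

theorem descRank_le {A : Type*} [LinearOrder A] (v : Fin n → A) (i : Fin n) : descRank v i ≤ n :=
  (Finset.card_le_univ _).trans_eq (Fintype.card_fin n)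

theorem sum_monomial_one_injective [Nontrivial R] {σ : Type*} :
    Function.Injective fun s : Finset (σ →₀ ℕ) => ∑ u ∈ s, monomial u (1 : R) := by
  classical
  intro s s' h
  ext u
  have := congrArg (coeff u) h
  simp only [coeff_sum, coeff_monomial, Finset.sum_ite_eq'] at this
  by_cases hs : u ∈ s <;> by_cases hs' : u ∈ s' <;> simp_all

/-- The exponent `(βᵢ, n - kᵢ(β))` of the monomial `t ^ n * β̄ᵢ` in `q` and `t`. -/
def spectralExponent (β : Fin n → ℕ) : Fin n ↪ (Fin 2 →₀ ℕ) where
  toFun i := Finsupp.equivFunOnFinite.symm ![β i, n - descRank β i]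
  inj' i j h := descRank_injective β <| by
    have : n - descRank β i = n - descRank β j := DFunLike.congr_fun h 1
    have := descRank_le β i
    have := descRank_le β j
    omega

theorem aeval_monomial_spectralExponent (ht : t ≠ 0) (β : Fin n → ℕ) (i : Fin n) :
    aeval ![q, t] (monomial (spectralExponent β i) (1 : R)) = t ^ n * spectralVector q t β i := by
  have : aeval ![q, t] (monomial (spectralExponent β i) (1 : R)) =
      q ^ β i * t ^ (n - descRank β i) := aeval_monomial_pair q t _
  rw [this, spectralVector, pow_sub₀ _ ht (descRank_le β i), inv_pow]
  ring

/-- The sum is `t ^ (-n)` times a polynomial in `q` and `t`, whose exponents of `q` are the entries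
of `β`. -/
theorem columnLength_eq_of_sum_spectralVector_eq (h : AlgebraicIndependent R ![q, t])
    {α β : Fin n → ℕ} (hsum : ∑ k, spectralVector q t β k = ∑ k, spectralVector q t α k) :
    columnLength β = columnLength α := by
  have : Nontrivial R := (algebraMap R F).domain_nontrivial
  have ht : t ≠ 0 := h.ne_zero 1
  have aeval_sum (γ : Fin n → ℕ) :
      aeval ![q, t] (∑ u ∈ Finset.univ.map (spectralExponent γ), monomial u (1 : R)) =
        t ^ n * ∑ k, spectralVector q t γ k := by
    simp only [Finset.sum_map, map_sum, aeval_monomial_spectralExponent ht, Finset.mul_sum]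
  have exponents_eq : Finset.univ.map (spectralExponent β) =
      Finset.univ.map (spectralExponent α) :=
    sum_monomial_one_injective (R := R) <| h <| by rw [aeval_sum, aeval_sum, hsum]
  have columnLength_eq (γ : Fin n → ℕ) (j : ℕ) : columnLength γ j =
      ((Finset.univ.map (spectralExponent γ)).filter (j < · 0)).card := by
    rw [Finset.filter_map, Finset.card_map]
    rfl
  funext j
  rw [columnLength_eq, columnLength_eq, exponents_eq]

end AlgebraicIndependence

section DualSpectralVectors
variable {F : Type*} [Field F] {n : ℕ}

theorem descRank_neg_rev_add_descRank_rev {A : Type*} [AddCommGroup A] [LinearOrder A]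
    [IsOrderedAddMonoid A] (v : Fin n → A) (i : Fin n) :
    descRank (fun k => -v k.rev) i + descRank v i.rev + 1 = n := by
  have descRank_neg_rev : descRank (fun k => -v k.rev) i =
      ∑ k, if v k < v i.rev ∨ (v i.rev = v k ∧ i.rev < k) then 1 else 0 := by
    rw [descRank_eq_sum, ← Equiv.sum_comp Fin.revPerm]
    simp only [Fin.revPerm_apply, Fin.rev_rev, neg_lt_neg_iff, neg_inj, Fin.rev_lt_iff]
  have sum_eq_one : ∑ k, (if k = i.rev then 1 else 0) = 1 := Fintype.sum_ite_eq' i.rev fun _ => 1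
  rw [descRank_neg_rev, descRank_eq_sum, ← Finset.sum_add_distrib]
  nth_rw 3 [← sum_eq_one]
  rw [← Finset.sum_add_distrib]
  calc _ = ∑ _k : Fin n, 1 := Finset.sum_congr rfl fun k _ => by
        rcases lt_trichotomy (v k) (v i.rev) with h | h | h <;> grind
    _ = n := by simp

/-- The spectral vector of `(-βₙ, …, -β₁)`. -/
def dualSpectralVector (q t : F) (β : Fin n → ℕ) : Fin n → F :=
  fun i => q⁻¹ ^ β i.rev * t⁻¹ ^ descRank (fun k => -(β k.rev : ℤ)) i

theorem descRank_natCast (β : Fin n → ℕ) : descRank (fun i => (β i : ℤ)) = descRank β := by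
  funext i
  simp [descRank]

theorem dualSpectralVector_apply (q : F) {t : F} (ht : t ≠ 0) (β : Fin n → ℕ) (i : Fin n) :
    dualSpectralVector q t β i = t⁻¹ ^ (n - 1) * spectralVector q⁻¹ t⁻¹ β i.rev := by
  have hrank := descRank_neg_rev_add_descRank_rev (fun k => (β k : ℤ)) i
  rw [descRank_natCast] at hrank
  have hn : n - 1 = descRank (fun k => -(β k.rev : ℤ)) i + descRank β i.rev := by omega
  have hcancel : t⁻¹ ^ descRank β i.rev * t ^ descRank β i.rev = 1 := by
    rw [← mul_pow, inv_mul_cancel₀ ht, one_pow]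
  rw [dualSpectralVector, spectralVector, hn, pow_add, inv_inv, mul_mul_mul_comm, mul_assoc,
    hcancel]
  ring

end DualSpectralVectors

section ScaleRev

theorem aeval_mul_of_isHomogeneous {σ R A : Type*} [CommSemiring R] [CommSemiring A] [Algebra R A]
    {d : ℕ} {f : MvPolynomial σ R} (hf : f.IsHomogeneous d) (c : A) (x : σ → A) :
    aeval (fun i => c * x i) f = c ^ d * aeval x f := by
  rw [f.as_sum, map_sum, map_sum, Finset.mul_sum]
  refine Finset.sum_congr rfl fun u hu => ?_
  have hdegree : ∑ i ∈ u.support, u i = d := by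
    rw [← Finsupp.degree_apply, Finsupp.degree_eq_weight_one]
    exact hf (mem_support_iff.mp hu)
  simp only [aeval_monomial, Finsupp.prod, mul_pow, Finset.prod_mul_distrib,
    Finset.prod_pow_eq_pow_sum, hdegree]
  ring

variable {F : Type*} [Field F] {n : ℕ}

/-- The algebra endomorphism `f(x₁, …, xₙ) ↦ f(c xₙ, …, c x₁)`. -/
def scaleRev (c : F) : MvPolynomial (Fin n) F →ₐ[F] MvPolynomial (Fin n) F :=
  aeval fun i => C c * X i.rev

theorem aeval_scaleRev {A : Type*} [CommRing A] [Algebra F A] (c : F) (x : Fin n → A)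
    (f : MvPolynomial (Fin n) F) :
    aeval x (scaleRev c f) = aeval (fun i => algebraMap F A c * x i.rev) f := by
  rw [scaleRev, comp_aeval_apply]
  simp [← algebraMap_eq]

theorem eval_scaleRev (c : F) (x : Fin n → F) (f : MvPolynomial (Fin n) F) :
    eval x (scaleRev c f) = eval (fun i => c * x i.rev) f :=
  aeval_scaleRev c x f

theorem scaleRev_scaleRev {c d : F} (h : c * d = 1) (f : MvPolynomial (Fin n) F) :
    scaleRev c (scaleRev d f) = f := by
  conv_rhs => rw [← aeval_X_left_apply f]
  rw [scaleRev, aeval_scaleRev]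
  congr 2
  funext i
  rw [Fin.rev_rev, algebraMap_eq, ← mul_assoc, ← C_mul, mul_comm d, h, C_1, one_mul]

theorem scaleRev_of_isHomogeneous (c : F) {d : ℕ} {f : MvPolynomial (Fin n) F}
    (hf : f.IsHomogeneous d) : scaleRev c f = c ^ d • rename Fin.rev f := by
  rw [scaleRev, aeval_mul_of_isHomogeneous hf, ← C_pow, smul_eq_C_mul, rename_eq_aeval]
  rfl

theorem isHomogeneousMap_scaleRev (c : F) :
    IsHomogeneousMap 0 (scaleRev (n := n) c).toLinearMap :=
  isHomogeneousMap_aeval fun i => by simpa using (isHomogeneous_C _ c).mul (isHomogeneous_X F i.rev)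

theorem homogeneousComponent_scaleRev (c : F) (d : ℕ) (f : MvPolynomial (Fin n) F) :
    homogeneousComponent d (scaleRev c f) = scaleRev c (homogeneousComponent d f) :=
  (isHomogeneousMap_scaleRev c).homogeneousComponent_apply f d

theorem totalDegree_scaleRev_le (c : F) {d : ℕ} {f : MvPolynomial (Fin n) F}
    (hf : f.totalDegree ≤ d) : (scaleRev c f).totalDegree ≤ d :=
  (isHomogeneousMap_scaleRev c).totalDegree_le hf

end ScaleRev

section InterpolationPolynomials
variable {F : Type*} [Field F] {n : ℕ} {q t : F}

/-- The characterizing properties of the interpolation polynomial `G_α` with parameters in an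
arbitrary field. -/
structure IsInterpolationPolynomial (q t : F) (α : Fin n → ℕ) (P : MvPolynomial (Fin n) F) :
    Prop where
  degree_le : P.totalDegree ≤ size α
  vanishing : ∀ β, size β ≤ size α → β ≠ α → eval (spectralVector q t β) P = 0
  normalized : P.coeff (Finsupp.equivFunOnFinite.symm α) = 1

/-- The characterizing properties of the primed interpolation polynomial `G'_α` with parameters in
an arbitrary field, where `P` plays the role of `G_α`. -/
structure IsPrimedInterpolationPolynomial (q t : F) (α : Fin n → ℕ)
    (P P' : MvPolynomial (Fin n) F) : Prop where
  degree_le : P'.totalDegree ≤ size α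
  top_eq : homogeneousComponent (size α) P' = homogeneousComponent (size α) P
  vanishing : ∀ β, size β < size α → eval (dualSpectralVector q t β) P' = 0

theorem IsGeneric.existsUnique_isInterpolationPolynomial (hg : IsGeneric q t) (α : Fin n → ℕ) :
    ∃! P, IsInterpolationPolynomial q t α P := by
  obtain ⟨f, hd, hf, hcoeff⟩ := hg.exists_vanishing_of_coeff_eq_one α
  refine ⟨f, ⟨hd, hf, hcoeff⟩, fun P hP => ?_⟩
  exact hg.eq_of_eval_of_coeff_eq hP.degree_le hd
    (fun β hβ hne => by rw [hf β hβ hne, hP.vanishing β hβ hne]) (by rw [hcoeff, hP.normalized])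

theorem eval_dualSpectralVector (ht : t ≠ 0) (β : Fin n → ℕ) (f : MvPolynomial (Fin n) F) :
    eval (dualSpectralVector q t β) f =
      eval (spectralVector q⁻¹ t⁻¹ β) (scaleRev (t⁻¹ ^ (n - 1)) f) := by
  rw [eval_scaleRev]
  congr 2
  exact funext (dualSpectralVector_apply q ht β)

/-- `scaleRev` turns the dual spectral vectors into the spectral vectors with inverted parameters,
where a leading part can be prescribed freely. -/
theorem IsGeneric.existsUnique_isPrimedInterpolationPolynomial (hg : IsGeneric q t) (α : Fin n → ℕ)
    (P : MvPolynomial (Fin n) F) : ∃! P', IsPrimedInterpolationPolynomial q t α P P' := by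
  have hc : t ^ (n - 1) * t⁻¹ ^ (n - 1) = 1 := by
    rw [← mul_pow, mul_inv_cancel₀ hg.t_ne_zero, one_pow]
  obtain ⟨f, hd, htop, hf⟩ := hg.inv.exists_vanishing_of_homogeneousComponent_eq
    (p := scaleRev (t⁻¹ ^ (n - 1)) (homogeneousComponent (size α) P)) (by
      rw [← homogeneousComponent_scaleRev]
      exact homogeneousComponent_isHomogeneous _ _)
  refine ⟨scaleRev (t ^ (n - 1)) f, ⟨totalDegree_scaleRev_le _ hd, ?_, fun β hβ => ?_⟩,
    fun P' hP' => ?_⟩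
  · rw [homogeneousComponent_scaleRev, htop, scaleRev_scaleRev hc]
  · rw [eval_dualSpectralVector hg.t_ne_zero, scaleRev_scaleRev (mul_comm _ _ |>.trans hc)]
    exact hf β hβ
  · rw [← scaleRev_scaleRev hc P']
    congr 1
    refine hg.inv.eq_of_homogeneousComponent_eq_of_eval_eq
      (totalDegree_scaleRev_le _ hP'.degree_le) hd ?_ fun β hβ => ?_
    · rw [htop, homogeneousComponent_scaleRev, hP'.top_eq]
    · rw [hf β hβ, ← eval_dualSpectralVector hg.t_ne_zero, hP'.vanishing β hβ]

variable {K : Type*} [Field K] [Algebra F K]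

theorem IsInterpolationPolynomial.eq_smul_interpolationBasis (hg : IsGeneric q t) {α : Fin n → ℕ}
    {P : MvPolynomial (Fin n) F} (hP : IsInterpolationPolynomial q t α P) :
    P = eval (spectralVector q t α) P • interpolationBasis hg α :=
  NonsymmetricInterpolation.eq_smul_interpolationBasis hg hP.degree_le hP.vanishing

theorem IsInterpolationPolynomial.aeval_principal (hg : IsGeneric q t) {α : Fin n → ℕ}
    {P : MvPolynomial (Fin n) F} (hP : IsInterpolationPolynomial q t α P) (c : K) :
    aeval (fun i : Fin n => c * algebraMap F K (t⁻¹ ^ (i : ℕ))) P =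
      algebraMap F K (eval (fun i : Fin n => t⁻¹ ^ (i : ℕ)) (homogeneousComponent (size α) P)) *
        ∏ j ∈ Finset.range (size α), ∏ i ∈ Finset.range (columnLength α j),
          (c - algebraMap F K (q ^ j * t⁻¹ ^ i)) :=
  aeval_eq_mul_prod_of_eval_eq_zero hg hP.degree_le (fun i j h => by
    rw [hP.eq_smul_interpolationBasis hg, smul_eval,
      eval_interpolationBasis_of_lt_columnLength hg h, mul_zero]) c

theorem inv_pow_mul_pow_rev (ht : t ≠ 0) (i : Fin n) :
    t⁻¹ ^ (n - 1) * t ^ (i.rev : ℕ) = t⁻¹ ^ (i : ℕ) := by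
  have hn : n - 1 = i + (i.rev : ℕ) := by
    rw [Fin.val_rev]
    omega
  rw [hn, pow_add, mul_assoc, ← mul_pow, inv_mul_cancel₀ ht, one_pow, mul_one]

theorem IsPrimedInterpolationPolynomial.aeval_principal (hg : IsGeneric q t) {α : Fin n → ℕ}
    (hsep : ∀ β : Fin n → ℕ, ∑ k, spectralVector q t β k = ∑ k, spectralVector q t α k →
      columnLength β = columnLength α)
    {P P' : MvPolynomial (Fin n) F} (hP : IsInterpolationPolynomial q t α P)
    (hP' : IsPrimedInterpolationPolynomial q t α P P') (c : K) :
    aeval (fun i : Fin n => c * algebraMap F K (t⁻¹ ^ (i : ℕ))) P' =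
      algebraMap F K (eval (fun i : Fin n => t⁻¹ ^ (i : ℕ)) (homogeneousComponent (size α) P)) *
        ∏ j ∈ Finset.range (size α), ∏ i ∈ Finset.range (columnLength α j),
          (c - algebraMap F K (q⁻¹ ^ j * t⁻¹⁻¹ ^ i)) := by
  have hd := totalDegree_scaleRev_le (t⁻¹ ^ (n - 1)) hP'.degree_le
  have htop : homogeneousComponent (size α) (scaleRev (t⁻¹ ^ (n - 1)) P') =
      scaleRev (t⁻¹ ^ (n - 1)) (homogeneousComponent (size α) P) := by
    rw [homogeneousComponent_scaleRev, hP'.top_eq]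
  have leadingPart_eq : homogeneousComponent (size α) P =
      eval (spectralVector q t α) P • leadingPart hg α := by
    conv_lhs => rw [hP.eq_smul_interpolationBasis hg, map_smul]
    rfl
  have htop_smul : homogeneousComponent (size α) (scaleRev (t⁻¹ ^ (n - 1)) P') =
      ((t⁻¹ ^ (n - 1)) ^ size α * eval (spectralVector q t α) P) •
        rename Fin.rev (leadingPart hg α) := by
    rw [htop, scaleRev_of_isHomogeneous _ (homogeneousComponent_isHomogeneous _ _), mul_smul,
      leadingPart_eq, map_smul]
  have hf (β : Fin n → ℕ) (hβ : size β < size α) :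
      eval (spectralVector q⁻¹ t⁻¹ β) (scaleRev (t⁻¹ ^ (n - 1)) P') = 0 := by
    rw [← eval_dualSpectralVector hg.t_ne_zero, hP'.vanishing β hβ]
  have key := aeval_eq_mul_prod_of_eval_eq_zero hg.inv (K := K) hd
    (fun i j h => eval_eq_zero_of_rename_rev_leadingPart hg hsep hd htop_smul hf h) c
  simpa only [htop, aeval_scaleRev, eval_scaleRev, mul_left_comm _ c, ← map_mul, inv_inv,
    inv_pow_mul_pow_rev hg.t_ne_zero] using key

end InterpolationPolynomials

section RationalFunctions
open InterpolationMacdonald (BaseField bar tilde toInt kIndex IsInterpolation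
  IsPrimedInterpolation G)
variable {n : ℕ}

theorem algebraicIndependent_q_t :
    AlgebraicIndependent ℚ ![InterpolationMacdonald.q, InterpolationMacdonald.t] := by
  have := (algebraicIndependent_X (Fin 2) ℚ).map'
    (f := IsScalarTower.toAlgHom ℚ (MvPolynomial (Fin 2) ℚ) BaseField)
    (IsFractionRing.injective (MvPolynomial (Fin 2) ℚ) BaseField)
  convert this using 1
  funext i
  fin_cases i <;> rfl

theorem kIndex_eq_descRank (v : Fin n → ℤ) : kIndex v = descRank v := by
  funext i
  rw [kIndex, descRank, ← Finset.card_union_of_disjoint (Finset.disjoint_filter.mpr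
    fun k _ h h' => h.1.not_gt h'.1)]
  congr 1
  ext k
  simp only [Finset.mem_union, Finset.mem_filter, Finset.mem_univ, true_and]
  grind

theorem bar_toInt (β : Fin n → ℕ) :
    bar (toInt β) = spectralVector InterpolationMacdonald.q InterpolationMacdonald.t β := by
  funext i
  have : kIndex (toInt β) i = descRank β i := by rw [kIndex_eq_descRank, ← descRank_natCast]; rfl
  simp [bar, this, spectralVector, toInt]

theorem tilde_toInt (β : Fin n → ℕ) :
    tilde (toInt β) = dualSpectralVector InterpolationMacdonald.q InterpolationMacdonald.t β := by
  funext i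
  simp [tilde, bar, kIndex_eq_descRank, dualSpectralVector, toInt]

theorem isInterpolation_iff {α : Fin n → ℕ} {P : MvPolynomial (Fin n) BaseField} :
    IsInterpolation α P ↔
      IsInterpolationPolynomial InterpolationMacdonald.q InterpolationMacdonald.t α P := by
  constructor <;> rintro ⟨hd, hv, hc⟩ <;> exact ⟨hd, by simpa only [bar_toInt] using hv, hc⟩

theorem isPrimedInterpolation_iff {α : Fin n → ℕ} {P' : MvPolynomial (Fin n) BaseField} :
    IsPrimedInterpolation α P' ↔ IsPrimedInterpolationPolynomial InterpolationMacdonald.q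
      InterpolationMacdonald.t α (G α) P' := by
  constructor <;> rintro ⟨hd, htop, hv⟩ <;> exact ⟨hd, htop, by simpa only [tilde_toInt] using hv⟩

end RationalFunctions

section Duality
open InterpolationMacdonald (armSum legSum plus)
variable {F K : Type*} [Field F] [Field K] [Algebra F K] {q t : F} {n : ℕ}

theorem prod_columns_inv_sub (hq : q ≠ 0) (ht : t ≠ 0) (α : Fin n → ℕ) {c : K} (hc : c ≠ 0) :
    ∏ j ∈ Finset.range (size α), ∏ i ∈ Finset.range (columnLength α j),
        (c⁻¹ - algebraMap F K (q⁻¹ ^ j * t⁻¹⁻¹ ^ i)) =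
      (algebraMap F K ((-1) ^ size α * q ^ armSum α * t⁻¹ ^ legSum (plus α)))⁻¹ *
        c⁻¹ ^ size α * ∏ j ∈ Finset.range (size α), ∏ i ∈ Finset.range (columnLength α j),
          (c - algebraMap F K (q ^ j * t⁻¹ ^ i)) := by
  have hne (j i : ℕ) : algebraMap F K (q ^ j * t⁻¹ ^ i) ≠ 0 :=
    (map_ne_zero _).mpr (mul_ne_zero (pow_ne_zero _ hq) (pow_ne_zero _ (inv_ne_zero ht)))
  have hinv (j i : ℕ) : algebraMap F K (q⁻¹ ^ j * t⁻¹⁻¹ ^ i) =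
      (algebraMap F K (q ^ j * t⁻¹ ^ i))⁻¹ := by
    rw [← map_inv₀, mul_inv, inv_pow, inv_pow t⁻¹]
  simp only [hinv]
  rw [prod_columns_inv_sub_inv α hc hne, mul_assoc ((-1) ^ size α), ← prod_columns_pow_mul_pow]
  simp only [map_mul, map_prod, map_pow, map_neg, map_one]

end Duality

end NonsymmetricInterpolation

end

open NonsymmetricInterpolation MvPolynomial in
theorem mainTheorem7_general {R F K : Type*} [CommRing R] [Field F] [Algebra R F] [Field K]
    [Algebra F K] {q t : F} (hqt : AlgebraicIndependent R ![q, t]) {c : K} (hc : c ≠ 0) {n : ℕ}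
    (α : Fin n → ℕ) :
    (∃! P, IsInterpolationPolynomial q t α P) ∧
      ∀ P, IsInterpolationPolynomial q t α P →
        (∃! P', IsPrimedInterpolationPolynomial q t α P P') ∧
        ∀ P', IsPrimedInterpolationPolynomial q t α P P' →
          aeval (fun i : Fin n => c⁻¹ * algebraMap F K (t ^ (-(i : ℤ)))) P' =
            (algebraMap F K ((-1) ^ InterpolationMacdonald.size α *
                q ^ InterpolationMacdonald.armSum α *
                t ^ (-(InterpolationMacdonald.legSum (InterpolationMacdonald.plus α) : ℤ))))⁻¹ *
              c ^ (-(InterpolationMacdonald.size α : ℤ)) *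
              aeval (fun i : Fin n => c * algebraMap F K (t ^ (-(i : ℤ)))) P := by
  have hg := isGeneric_of_algebraicIndependent hqt
  refine ⟨hg.existsUnique_isInterpolationPolynomial α, fun P hP =>
    ⟨hg.existsUnique_isPrimedInterpolationPolynomial α P, fun P' hP' => ?_⟩⟩
  have hsep (β : Fin n → ℕ) := columnLength_eq_of_sum_spectralVector_eq hqt (α := α) (β := β)
  simp only [zpow_neg, zpow_natCast, ← inv_pow]
  rw [hP'.aeval_principal hg hsep hP, hP.aeval_principal hg,
    prod_columns_inv_sub hg.q_ne_zero hg.t_ne_zero α hc, mul_left_comm]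

theorem mainTheorem7 (n : ℕ) (α : Fin n → ℕ) :
    (∃! P, InterpolationMacdonald.IsInterpolation α P) ∧
    (∃! P, InterpolationMacdonald.IsPrimedInterpolation α P) ∧
    InterpolationMacdonald.evalTau (InterpolationMacdonald.GPrime α) InterpolationMacdonald.a⁻¹ =
      (algebraMap InterpolationMacdonald.BaseField InterpolationMacdonald.ParamField
          (InterpolationMacdonald.tauComp α))⁻¹ *
        InterpolationMacdonald.a ^ (-(InterpolationMacdonald.size α : ℤ)) *
        InterpolationMacdonald.evalTau (InterpolationMacdonald.G α) InterpolationMacdonald.a := by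
  obtain ⟨hG, h⟩ := mainTheorem7_general NonsymmetricInterpolation.algebraicIndependent_q_t
    (c := InterpolationMacdonald.a) RatFunc.X_ne_zero α
  simp only [← NonsymmetricInterpolation.isInterpolation_iff] at hG h
  obtain ⟨hG', h⟩ := h (InterpolationMacdonald.G α) (Classical.epsilon_spec hG.exists)
  simp only [← NonsymmetricInterpolation.isPrimedInterpolation_iff] at hG' h
  exact ⟨hG, hG', h _ (Classical.epsilon_spec hG'.exists)⟩
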